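/- Let $\Bbbk$ be a field and let $E$ be a quasi-separable $\Bbbk$-algebra, i.e. $E$ is commutative, finite-dimensional over $\Bbbk$, and the reduced algebra $E/\mathrm{nil}(E)$ is separable over $\Bbbk$. Let $\mathcal{C}$ be a $\Bbbk$-linear abelian category with a symmetric monoidal structure $\otimes$ that is $\Bbbk$-linear and exact in each variable. An *$E$-module in $\mathcal{C}$* is an object $X$ of $\mathcal{C}$ with a $\Bbbk$-algebra map $E\to\mathrm{End}(X)$; morphisms are the morphisms of $\mathcal{C}$ that commute with the action of $E$. For a finite-dimensional $\Bbbk$-vector space $V$, let $V\otimes X$ denote the object with $\mathrm{Hom}(V\otimes X,Y)=\mathrm{Hom}_\Bbbk(V,\mathrm{Hom}(X,Y))$. For a finitely generated $E$-module $M$ let $M\otimes_E X$ be the coequaliser of the two action maps $M\otimes_\Bbbk E\otimes X\rightrightarrows M\otimes X$; $X$ is *flat* if $M\mapsto M\otimes_E X$ is an exact functor from finitely generated $E$-modules to $\mathcal{C}$. For $E$-modules $Y,X$ in $\mathcal{C}$ let $Y\otimes_E X$ be the coequaliser of the two action maps $E\otimes Y\otimes X\rightrightarrows Y\otimes X$,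 with the induced $E$-action. Let $X$ be an $E$-module in $\mathcal{C}$. 1. If $X$ is flat, then the functor $Y\mapsto Y\otimes_E X$ from $E$-modules in $\mathcal{C}$ to $E$-modules in $\mathcal{C}$ is exact. 2. Suppose that $\mathcal{C}$ is rigid. Let $X^\vee$ be the dual of $X$ with the transposed action of $E$, and let $\underline{\mathrm{Hom}}_E(Y,Z)$ be the equaliser of the two actions of $E$ on the internal Hom object $\underline{\mathrm{Hom}}(Y,Z)$, with the induced $E$-action. Then the following are equivalent: (a) $X$ is flat; (b) the functor $Y\mapsto Y\otimes_E X$ on $E$-modules in $\mathcal{C}$ is exact; (c) the contravariant functor $Y\mapsto\underline{\mathrm{Hom}}_E(Y,X^\vee)$ from $E$-modules in $\mathcal{C}$ to itself is exact. -/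

import Mathlib

open CategoryTheory Limits MonoidalCategory

universe w v u

/-- A `k`-algebra is quasi-separable if it is commutative, finite over `k`, and the associated
reduced algebra is separable over `k`. -/
class QuasiSeparable (k : Type*) (E : Type*) [Field k] [CommRing E] [Algebra k E] : Prop where
  finite : Module.Finite k E
  separable : Algebra.IsSeparable k (E ⧸ nilradical E)

attribute [instance] QuasiSeparable.finite

noncomputable section

namespace LinCat

attribute [local instance] Abelian.hasFiniteBiproducts

/-! ### The action `V ⊗ X` of finite dimensional vector spaces on a linear category -/

section Copower

variable {k : Type*} [Field k] {C : Type u} [Category.{v} C] [Abelian C] [Linear k C]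
variable (V : Type*) [AddCommGroup V] [Module k V] [Module.Finite k V]
variable {W : Type*} [AddCommGroup W] [Module k W] [Module.Finite k W]

variable (k) in
/-- The object `V ⊗ X`, for a finite dimensional vector space `V`: it is characterised by
`Hom(V ⊗ X, Y) = Hom_k(V, Hom(X, Y))`, see `copowerEquiv`. -/
def copower (X : C) : C :=
  biproduct (fun _ : Fin (Module.finrank k V) => X)

variable (k) in
/-- The universal linear map `V → Hom(X, V ⊗ X)`. -/
def copowerι (X : C) : V →ₗ[k] (X ⟶ copower k V X) :=
  (Module.finBasis k V).constr k
    (fun i => biproduct.ι (fun _ : Fin (Module.finrank k V) => X) i)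

variable {V}

theorem copowerι_basis (X : C) (i : Fin (Module.finrank k V)) :
    copowerι k V X (Module.finBasis k V i) =
      biproduct.ι (fun _ : Fin (Module.finrank k V) => X) i :=
  (Module.finBasis k V).constr_basis k _ i

/-- The morphism `V ⊗ X ⟶ Y` corresponding to a linear map `V → Hom(X, Y)`. -/
def copowerDesc {X Y : C} (φ : V →ₗ[k] (X ⟶ Y)) : copower k V X ⟶ Y :=
  biproduct.desc (fun i => φ (Module.finBasis k V i))

theorem copowerι_desc {X Y : C} (φ : V →ₗ[k] (X ⟶ Y)) (x : V) :
    copowerι k V X x ≫ copowerDesc φ = φ x := by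
  have : (Linear.rightComp k X (copowerDesc φ)).comp (copowerι k V X) = φ := by
    refine (Module.finBasis k V).ext fun i => ?_
    change copowerι k V X (Module.finBasis k V i) ≫ copowerDesc φ = _
    rw [copowerι_basis]
    exact biproduct.ι_desc _ _
  exact LinearMap.congr_fun this x

theorem copower_hom_ext {X Y : C} {f g : copower k V X ⟶ Y}
    (h : ∀ x : V, copowerι k V X x ≫ f = copowerι k V X x ≫ g) : f = g := by
  refine biproduct.hom_ext' _ _ fun i => ?_
  rw [← copowerι_basis]
  exact h (Module.finBasis k V i)

variable (k V) in
/-- The universal property of `V ⊗ X`. -/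
def copowerEquiv (X Y : C) : (copower k V X ⟶ Y) ≃ (V →ₗ[k] (X ⟶ Y)) where
  toFun f := (Linear.rightComp k X f).comp (copowerι k V X)
  invFun φ := copowerDesc φ
  left_inv f := copower_hom_ext fun x => by rw [copowerι_desc]; rfl
  right_inv φ := LinearMap.ext fun x => copowerι_desc φ x

/-- Functoriality of `V ⊗ X` in `V`. -/
def copowerMap (g : V →ₗ[k] W) (X : C) : copower k V X ⟶ copower k W X :=
  copowerDesc ((copowerι k W X).comp g)

theorem copowerι_map (g : V →ₗ[k] W) (X : C) (x : V) :
    copowerι k V X x ≫ copowerMap g X = copowerι k W X (g x) :=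
  copowerι_desc _ x

/-! The dual object `Hom_k(V, X) = V^∨ ⊗ X`. -/

variable (k V) in
/-- The object `Hom_k(V, X) = V^∨ ⊗ X`. -/
abbrev power (X : C) : C := copower k (Module.Dual k V) X

/-- Evaluation `Hom_k(V, X) ⟶ X` at `x : V`. -/
def powerEval (x : V) (X : C) : power k V X ⟶ X :=
  copowerDesc ((LinearMap.toSpanSingleton k (X ⟶ X) (𝟙 X)).comp (Module.Dual.eval k V x))

/-- The morphism `Y ⟶ Hom_k(V, X)` corresponding to a linear map `V → Hom(Y, X)`. -/
def powerLift {X Y : C} (φ : V →ₗ[k] (Y ⟶ X)) : Y ⟶ power k V X :=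
  ∑ i, φ (Module.finBasis k V i) ≫ copowerι k (Module.Dual k V) X ((Module.finBasis k V).coord i)

theorem powerLift_eval {X Y : C} (φ : V →ₗ[k] (Y ⟶ X)) (x : V) :
    powerLift φ ≫ powerEval x X = φ x := by
  have h : ∀ i, copowerι k (Module.Dual k V) X ((Module.finBasis k V).coord i) ≫ powerEval x X
      = (Module.finBasis k V).repr x i • 𝟙 X := by
    intro i
    rw [powerEval, copowerι_desc]
    simp
  conv_rhs => rw [← (Module.finBasis k V).sum_repr x, map_sum]
  simp [powerLift, Preadditive.sum_comp, h]

theorem power_hom_ext {X Y : C} {f g : Y ⟶ power k V X}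
    (h : ∀ x : V, f ≫ powerEval x X = g ≫ powerEval x X) : f = g := by
  have key : ∑ i, powerEval (Module.finBasis k V i) X ≫
      copowerι k (Module.Dual k V) X ((Module.finBasis k V).coord i) = 𝟙 (power k V X) := by
    refine copower_hom_ext fun ξ => ?_
    rw [Preadditive.comp_sum, Category.comp_id]
    have : ∀ i, copowerι k (Module.Dual k V) X ξ ≫ powerEval (Module.finBasis k V i) X ≫
        copowerι k (Module.Dual k V) X ((Module.finBasis k V).coord i) =
        copowerι k (Module.Dual k V) X
          (ξ (Module.finBasis k V i) • (Module.finBasis k V).coord i) := by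
      intro i
      rw [powerEval, ← Category.assoc, copowerι_desc]
      simp
    rw [Finset.sum_congr rfl fun i _ => this i, ← map_sum,
      Module.Basis.sum_dual_apply_smul_coord]
  rw [← Category.comp_id f, ← Category.comp_id g, ← key, Preadditive.comp_sum,
    Preadditive.comp_sum]
  refine Finset.sum_congr rfl fun i _ => ?_
  rw [← Category.assoc, h, Category.assoc]

end Copower

/-! ### Modules in a linear category -/

section Modules

variable (k : Type*) [Field k] (E : Type w) [CommRing E] [Algebra k E]
variable (C : Type u) [Category.{v} C] [Abelian C] [Linear k C]

/-- An `E`-module in `C`: an object with a `k`-algebra map from `E` to its endomorphisms. -/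
structure EMod where
  X : C
  ρ : E →ₐ[k] End X

variable {k E C}

namespace EMod

/-- The action of `E` on the underlying object, as a linear map. -/
def act (M : EMod k E C) : E →ₗ[k] (M.X ⟶ M.X) := M.ρ.toLinearMap

theorem act_one (M : EMod k E C) : M.act 1 = 𝟙 M.X := map_one M.ρ

theorem act_mul (M : EMod k E C) (a b : E) : M.act (a * b) = M.act b ≫ M.act a :=
  map_mul M.ρ a b

theorem act_comm (M : EMod k E C) (a b : E) : M.act a ≫ M.act b = M.act b ≫ M.act a := by
  rw [← act_mul, ← act_mul, mul_comm]

/-- Build an `E`-module from a unital and multiplicative linear map. -/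
def ofAct (X : C) (a : E →ₗ[k] (X ⟶ X)) (h1 : a 1 = 𝟙 X)
    (hm : ∀ x y, a (x * y) = a y ≫ a x) : EMod k E C where
  X := X
  ρ := AlgHom.ofLinearMap (B := End X) a h1 hm

/-- A morphism of `E`-modules is a morphism that commutes with the action of `E`. -/
@[ext]
structure Hom (M N : EMod k E C) where
  hom : M.X ⟶ N.X
  comm : ∀ e : E, M.act e ≫ hom = hom ≫ N.act e

instance : Category (EMod k E C) where
  Hom M N := Hom M N
  id M := ⟨𝟙 M.X, by simp⟩
  comp f g := ⟨f.hom ≫ g.hom, fun e => by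
    rw [← Category.assoc, f.comm, Category.assoc, g.comm, Category.assoc]⟩

@[ext]
theorem hom_ext {M N : EMod k E C} {f g : M ⟶ N} (h : f.hom = g.hom) : f = g := Hom.ext h

@[simp]
theorem id_hom (M : EMod k E C) : Hom.hom (𝟙 M) = 𝟙 M.X := rfl

@[simp]
theorem comp_hom {M N P : EMod k E C} (f : M ⟶ N) (g : N ⟶ P) :
    (f ≫ g).hom = f.hom ≫ g.hom := rfl

end EMod

/-! ### The functor `M ↦ M ⊗_E X` on finite modules, and flatness -/

open scoped ModuleCat TensorProduct

instance finite_restrict [Module.Finite k E] (M : FGModuleCat.{w} E) :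
    Module.Finite k M.obj :=
  haveI : Module.Finite E M.obj := M.property
  Module.Finite.trans E M.obj

variable [Module.Finite k E]

/-- `M ⊗ E ⊗ X ⟶ M ⊗ X`, the action of `E` on `M`. -/
def actOnModule (M : FGModuleCat.{w} E) (X : EMod k E C) :
    copower k (M.obj ⊗[k] E) X.X ⟶ copower k M.obj X.X :=
  copowerDesc (TensorProduct.lift
    (LinearMap.mk₂ k (fun (m : M.obj) (e : E) => copowerι k M.obj X.X (e • m))
      (fun m m' e => by rw [smul_add, map_add])
      (fun c m e => by rw [smul_comm, map_smul])
      (fun m e e' => by rw [add_smul, map_add])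
      (fun c m e => by rw [smul_assoc, map_smul])))

/-- `M ⊗ E ⊗ X ⟶ M ⊗ X`, the action of `E` on `X`. -/
def actOnObject (M : FGModuleCat.{w} E) (X : EMod k E C) :
    copower k (M.obj ⊗[k] E) X.X ⟶ copower k M.obj X.X :=
  copowerDesc (TensorProduct.lift
    (LinearMap.mk₂ k (fun (m : M.obj) (e : E) => X.act e ≫ copowerι k M.obj X.X m)
      (fun m m' e => by rw [map_add, Preadditive.comp_add])
      (fun c m e => by rw [map_smul, Linear.comp_smul])
      (fun m e e' => by rw [map_add, Preadditive.add_comp])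
      (fun c m e => by rw [map_smul, Linear.smul_comp])))

/-- `M ⊗_E X`, the coequaliser of `M ⊗ E ⊗ X ⇉ M ⊗ X`. -/
def extObj (M : FGModuleCat.{w} E) (X : EMod k E C) : C :=
  coequalizer (actOnModule M X) (actOnObject M X)

def extπ (M : FGModuleCat.{w} E) (X : EMod k E C) : copower k M.obj X.X ⟶ extObj M X :=
  coequalizer.π _ _

theorem ext_condition (M : FGModuleCat.{w} E) (X : EMod k E C) (m : M.obj) (e : E) :
    copowerι k M.obj X.X (e • m) ≫ extπ M X = X.act e ≫ copowerι k M.obj X.X m ≫ extπ M X := by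
  have := congrArg (fun f => copowerι k (M.obj ⊗[k] E) X.X (m ⊗ₜ e) ≫ f)
    (coequalizer.condition (actOnModule M X) (actOnObject M X))
  have h1 : copowerι k (M.obj ⊗[k] E) X.X (m ⊗ₜ e) ≫ actOnModule M X =
      copowerι k M.obj X.X (e • m) := copowerι_desc _ _
  have h2 : copowerι k (M.obj ⊗[k] E) X.X (m ⊗ₜ e) ≫ actOnObject M X =
      X.act e ≫ copowerι k M.obj X.X m := copowerι_desc _ _
  simp only [← Category.assoc, h1, h2] at this
  rw [← Category.assoc]
  exact this

def extDesc (M : FGModuleCat.{w} E) (X : EMod k E C) {Z : C} (f : copower k M.obj X.X ⟶ Z)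
    (h : ∀ (m : M.obj) (e : E),
      copowerι k M.obj X.X (e • m) ≫ f = X.act e ≫ copowerι k M.obj X.X m ≫ f) :
    extObj M X ⟶ Z :=
  coequalizer.desc f (copower_hom_ext fun t => by
    simp only [← Category.assoc, actOnModule, actOnObject, copowerι_desc]
    induction t with
    | zero => simp
    | tmul m e => simpa using h m e
    | add a b ha hb => rw [map_add, map_add, Preadditive.add_comp, Preadditive.add_comp, ha, hb])

theorem extπ_desc (M : FGModuleCat.{w} E) (X : EMod k E C) {Z : C}
    (f : copower k M.obj X.X ⟶ Z) (h) : extπ M X ≫ extDesc M X f h = f :=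
  coequalizer.π_desc _ _

theorem ext_hom_ext (M : FGModuleCat.{w} E) (X : EMod k E C) {Z : C} {f g : extObj M X ⟶ Z}
    (h : ∀ m : M.obj, copowerι k M.obj X.X m ≫ extπ M X ≫ f =
      copowerι k M.obj X.X m ≫ extπ M X ≫ g) : f = g :=
  coequalizer.hom_ext (copower_hom_ext h)

/-- An `E`-linear map, as a `k`-linear map. -/
def toLin {M N : FGModuleCat.{w} E} (f : M ⟶ N) : M.obj →ₗ[k] N.obj :=
  f.hom.hom.restrictScalars k

/-- Functoriality of `M ⊗_E X` in `M`. -/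
def extMap {M N : FGModuleCat.{w} E} (f : M ⟶ N) (X : EMod k E C) : extObj M X ⟶ extObj N X :=
  extDesc M X (copowerMap (toLin f) X.X ≫ extπ N X) (fun m e => by
    simp only [← Category.assoc, copowerι_map]
    have h : toLin (k := k) f (e • m) = e • toLin (k := k) f m := map_smul f.hom.hom e m
    rw [h, ext_condition, Category.assoc])

theorem ext_map {M N : FGModuleCat.{w} E} (f : M ⟶ N) (X : EMod k E C) (m : M.obj) :
    copowerι k M.obj X.X m ≫ extπ M X ≫ extMap f X =
      copowerι k N.obj X.X (f.hom.hom m) ≫ extπ N X := by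
  rw [extMap, extπ_desc, ← Category.assoc, copowerι_map]
  rfl

/-- The functor `M ↦ M ⊗_E X` from finite `E`-modules to `C`. -/
def extFunctor (X : EMod k E C) : FGModuleCat.{w} E ⥤ C where
  obj M := extObj M X
  map f := extMap f X
  map_id M := ext_hom_ext M X fun m => by
    rw [ext_map, Category.comp_id]; rfl
  map_comp {M N P} f g := ext_hom_ext M X fun m => by
    rw [ext_map, ← Category.assoc (extπ M X), ← Category.assoc, ext_map, Category.assoc, ext_map]
    rfl

/-- An `E`-module `X` in `C` is flat if the functor `M ↦ M ⊗_E X` on finite `E`-modules is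
exact. -/
def IsFlat (X : EMod k E C) : Prop :=
  exactFunctor (FGModuleCat.{w} E) C (extFunctor X)

end Modules

/-! ### The tensor product of modules -/

section Tensor

variable {k : Type*} [Field k] {E : Type w} [CommRing E] [Algebra k E] [Module.Finite k E]
variable {C : Type u} [Category.{v} C] [Abelian C] [Linear k C]
variable [MonoidalCategory C] [MonoidalPreadditive C] [MonoidalLinear k C]

/-- The action of `E` on `Y ⊗ X` through `Y`. -/
def actLeft (Y X : EMod k E C) : E →ₗ[k] (Y.X ⊗ X.X ⟶ Y.X ⊗ X.X) where
  toFun e := Y.act e ▷ X.X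
  map_add' a b := by simp
  map_smul' c a := by simp

/-- The action of `E` on `Y ⊗ X` through `X`. -/
def actRight (Y X : EMod k E C) : E →ₗ[k] (Y.X ⊗ X.X ⟶ Y.X ⊗ X.X) where
  toFun e := Y.X ◁ X.act e
  map_add' a b := by simp
  map_smul' c a := by simp

/-- The underlying object of `Y ⊗_E X`: the coequaliser of `E ⊗ Y ⊗ X ⇉ Y ⊗ X`. -/
def tensorObj (Y X : EMod k E C) : C :=
  coequalizer (copowerDesc (actLeft Y X)) (copowerDesc (actRight Y X))

def tensorπ (Y X : EMod k E C) : Y.X ⊗ X.X ⟶ tensorObj Y X :=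
  coequalizer.π _ _

theorem tensor_condition (Y X : EMod k E C) (e : E) :
    Y.act e ▷ X.X ≫ tensorπ Y X = Y.X ◁ X.act e ≫ tensorπ Y X := by
  have := congrArg (fun f => copowerι k E (Y.X ⊗ X.X) e ≫ f)
    (coequalizer.condition (copowerDesc (actLeft Y X)) (copowerDesc (actRight Y X)))
  simp only [← Category.assoc, copowerι_desc] at this
  exact this

def tensorDesc (Y X : EMod k E C) {Z : C} (f : Y.X ⊗ X.X ⟶ Z)
    (h : ∀ e : E, Y.act e ▷ X.X ≫ f = Y.X ◁ X.act e ≫ f) : tensorObj Y X ⟶ Z :=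
  coequalizer.desc f (copower_hom_ext fun e => by
    simp only [← Category.assoc, copowerι_desc]
    exact h e)

@[simp]
theorem tensorπ_desc (Y X : EMod k E C) {Z : C} (f : Y.X ⊗ X.X ⟶ Z) (h) :
    tensorπ Y X ≫ tensorDesc Y X f h = f :=
  coequalizer.π_desc _ _

@[simp]
theorem tensorπ_desc_assoc (Y X : EMod k E C) {Z W : C} (f : Y.X ⊗ X.X ⟶ Z) (h) (g : Z ⟶ W) :
    tensorπ Y X ≫ tensorDesc Y X f h ≫ g = f ≫ g := by
  rw [← Category.assoc, tensorπ_desc]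

theorem tensor_hom_ext (Y X : EMod k E C) {Z : C} {f g : tensorObj Y X ⟶ Z}
    (h : tensorπ Y X ≫ f = tensorπ Y X ≫ g) : f = g :=
  coequalizer.hom_ext h

/-- The action of `E` on `Y ⊗_E X`, induced by the action on `Y` (equivalently, on `X`). -/
def tensorAct (Y X : EMod k E C) : E →ₗ[k] (tensorObj Y X ⟶ tensorObj Y X) where
  toFun e := tensorDesc Y X (Y.act e ▷ X.X ≫ tensorπ Y X) (fun a => by
    rw [← Category.assoc, ← comp_whiskerRight, EMod.act_comm, comp_whiskerRight, Category.assoc,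
      tensor_condition, ← Category.assoc, ← whisker_exchange, Category.assoc])
  map_add' a b := tensor_hom_ext Y X (by simp [Preadditive.add_comp, Preadditive.comp_add])
  map_smul' c a := tensor_hom_ext Y X (by simp)

theorem tensorπ_act (Y X : EMod k E C) (e : E) :
    tensorπ Y X ≫ tensorAct Y X e = Y.act e ▷ X.X ≫ tensorπ Y X :=
  coequalizer.π_desc _ _

/-- The `E`-module `Y ⊗_E X`. -/
def tensorMod (Y X : EMod k E C) : EMod k E C :=
  EMod.ofAct (tensorObj Y X) (tensorAct Y X)
    (tensor_hom_ext Y X (by rw [tensorπ_act, EMod.act_one]; simp))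
    (fun a b => tensor_hom_ext Y X (by
      rw [tensorπ_act, EMod.act_mul, ← Category.assoc, tensorπ_act, Category.assoc, tensorπ_act]
      simp))

/-- Functoriality of `Y ⊗_E X` in `Y`. -/
def tensorMap {Y Y' : EMod k E C} (f : Y ⟶ Y') (X : EMod k E C) :
    tensorObj Y X ⟶ tensorObj Y' X :=
  tensorDesc Y X (f.hom ▷ X.X ≫ tensorπ Y' X) (fun e => by
    rw [← Category.assoc, ← comp_whiskerRight, f.comm, comp_whiskerRight, Category.assoc,
      tensor_condition, ← Category.assoc, ← whisker_exchange, Category.assoc])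

theorem tensorπ_map {Y Y' : EMod k E C} (f : Y ⟶ Y') (X : EMod k E C) :
    tensorπ Y X ≫ tensorMap f X = f.hom ▷ X.X ≫ tensorπ Y' X :=
  tensorπ_desc _ _ _ _

/-- The functor `Y ↦ Y ⊗_E X` from `E`-modules to `E`-modules. -/
def tensorFunctor (X : EMod k E C) : EMod k E C ⥤ EMod k E C where
  obj Y := tensorMod Y X
  map {Y Y'} f :=
    { hom := tensorMap f X
      comm := fun e => tensor_hom_ext Y X (by
        change tensorπ Y X ≫ tensorAct Y X e ≫ tensorMap f X =
          tensorπ Y X ≫ tensorMap f X ≫ tensorAct Y' X e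
        rw [← Category.assoc, tensorπ_act, Category.assoc, tensorπ_map,
          ← Category.assoc (tensorπ Y X), tensorπ_map, Category.assoc, tensorπ_act,
          ← Category.assoc, ← Category.assoc, ← comp_whiskerRight, ← comp_whiskerRight, f.comm]) }
  map_id Y := EMod.hom_ext (tensor_hom_ext Y X (by
    change tensorπ Y X ≫ tensorMap (𝟙 Y) X = tensorπ Y X ≫ 𝟙 (tensorObj Y X)
    rw [tensorπ_map]; simp))
  map_comp {Y Y' Y''} f g := EMod.hom_ext (tensor_hom_ext Y X (by
    change tensorπ Y X ≫ tensorMap (f ≫ g) X = tensorπ Y X ≫ tensorMap f X ≫ tensorMap g X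
    rw [tensorπ_map, ← Category.assoc, tensorπ_map, Category.assoc, tensorπ_map]; simp))

end Tensor

/-! ### Internal `Hom` of modules, and the dual of a module -/

section InternalHom

variable {k : Type*} [Field k] {E : Type w} [CommRing E] [Algebra k E]
variable {C : Type u} [Category.{v} C] [Abelian C] [Linear k C]
variable [MonoidalCategory C] [MonoidalPreadditive C] [MonoidalLinear k C]

/-- The dual object of an `E`-module, with the transposed action. -/
def dualMod [LeftRigidCategory C] (X : EMod k E C) : EMod k E C :=
  EMod.ofAct (ᘁX.X)
    { toFun e := ᘁ(X.act e)
      map_add' a b := by simp [leftAdjointMate, Preadditive.comp_add, Preadditive.add_comp]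
      map_smul' c a := by simp [leftAdjointMate] }
    (by
      change (ᘁ(X.act 1)) = _
      rw [EMod.act_one, leftAdjointMate_id])
    (fun a b => by
      change (ᘁ(X.act (a * b))) = (ᘁ(X.act b)) ≫ (ᘁ(X.act a))
      rw [← comp_leftAdjointMate, mul_comm, EMod.act_mul, EMod.act_comm, EMod.act_comm])

variable [MonoidalClosed C]

/-- The action of `E` on the internal `Hom` object from `Y` to `Z` through `Y`. -/
def ihomActSource (Y Z : EMod k E C) :
    E →ₗ[k] ((ihom Y.X).obj Z.X ⟶ (ihom Y.X).obj Z.X) where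
  toFun e := (MonoidalClosed.pre (Y.act e)).app Z.X
  map_add' a b := MonoidalClosed.uncurry_injective (by
    simp [MonoidalClosed.uncurry_eq, Preadditive.add_comp])
  map_smul' c a := MonoidalClosed.uncurry_injective (by
    simp [MonoidalClosed.uncurry_eq])

/-- The action of `E` on the internal `Hom` object from `Y` to `Z` through `Z`. -/
def ihomActTarget (Y Z : EMod k E C) :
    E →ₗ[k] ((ihom Y.X).obj Z.X ⟶ (ihom Y.X).obj Z.X) where
  toFun e := (ihom Y.X).map (Z.act e)
  map_add' a b := MonoidalClosed.uncurry_injective (by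
    simp [MonoidalClosed.uncurry_eq, Preadditive.add_comp, Preadditive.comp_add])
  map_smul' c a := MonoidalClosed.uncurry_injective (by
    simp [MonoidalClosed.uncurry_eq])

theorem ihomAct_comm (Y Z : EMod k E C) (a b : E) :
    ihomActTarget Y Z a ≫ ihomActSource Y Z b = ihomActSource Y Z b ≫ ihomActTarget Y Z a :=
  (MonoidalClosed.pre (Y.act b)).naturality (Z.act a)

theorem ihomActTarget_comm (Y Z : EMod k E C) (a b : E) :
    ihomActTarget Y Z a ≫ ihomActTarget Y Z b = ihomActTarget Y Z b ≫ ihomActTarget Y Z a := by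
  change (ihom Y.X).map _ ≫ (ihom Y.X).map _ = (ihom Y.X).map _ ≫ (ihom Y.X).map _
  rw [← Functor.map_comp, ← Functor.map_comp, EMod.act_comm]

variable [Module.Finite k E]

/-- The underlying object of `Hom_E(Y, Z)`: the equaliser of the two actions of `E` on the
internal `Hom` object from `Y` to `Z`. -/
def homObj (Y Z : EMod k E C) : C :=
  equalizer (powerLift (ihomActSource Y Z)) (powerLift (ihomActTarget Y Z))

def homι (Y Z : EMod k E C) : homObj Y Z ⟶ (ihom Y.X).obj Z.X :=
  equalizer.ι _ _

theorem hom_condition (Y Z : EMod k E C) (e : E) :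
    homι Y Z ≫ ihomActSource Y Z e = homι Y Z ≫ ihomActTarget Y Z e := by
  have := congrArg (fun f => f ≫ powerEval e _)
    (equalizer.condition (powerLift (ihomActSource Y Z)) (powerLift (ihomActTarget Y Z)))
  simp only [Category.assoc, powerLift_eval] at this
  exact this

def homLift (Y Z : EMod k E C) {W : C} (f : W ⟶ (ihom Y.X).obj Z.X)
    (h : ∀ e : E, f ≫ ihomActSource Y Z e = f ≫ ihomActTarget Y Z e) : W ⟶ homObj Y Z :=
  equalizer.lift f (power_hom_ext fun e => by
    simp only [Category.assoc, powerLift_eval]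
    exact h e)

@[simp]
theorem homLift_ι (Y Z : EMod k E C) {W : C} (f : W ⟶ (ihom Y.X).obj Z.X) (h) :
    homLift Y Z f h ≫ homι Y Z = f :=
  equalizer.lift_ι _ _

@[simp]
theorem homLift_ι_assoc (Y Z : EMod k E C) {W V : C} (f : W ⟶ (ihom Y.X).obj Z.X) (h)
    (g : (ihom Y.X).obj Z.X ⟶ V) : homLift Y Z f h ≫ homι Y Z ≫ g = f ≫ g := by
  rw [← Category.assoc, homLift_ι]

theorem homObj_hom_ext (Y Z : EMod k E C) {W : C} {f g : W ⟶ homObj Y Z}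
    (h : f ≫ homι Y Z = g ≫ homι Y Z) : f = g :=
  equalizer.hom_ext h

/-- The action of `E` on `Hom_E(Y, Z)`, induced by the action on `Z` (equivalently, on `Y`). -/
def homAct (Y Z : EMod k E C) : E →ₗ[k] (homObj Y Z ⟶ homObj Y Z) where
  toFun e := homLift Y Z (homι Y Z ≫ ihomActTarget Y Z e) (fun a => by
    rw [Category.assoc, ihomAct_comm, ← Category.assoc, hom_condition, Category.assoc,
      Category.assoc, ihomActTarget_comm])
  map_add' a b := homObj_hom_ext Y Z (by simp [Preadditive.add_comp, Preadditive.comp_add])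
  map_smul' c a := homObj_hom_ext Y Z (by simp)

theorem homAct_ι (Y Z : EMod k E C) (e : E) :
    homAct Y Z e ≫ homι Y Z = homι Y Z ≫ ihomActTarget Y Z e :=
  equalizer.lift_ι _ _

theorem homAct_ι_assoc (Y Z : EMod k E C) (e : E) {V : C} (g : (ihom Y.X).obj Z.X ⟶ V) :
    homAct Y Z e ≫ homι Y Z ≫ g = homι Y Z ≫ ihomActTarget Y Z e ≫ g := by
  rw [← Category.assoc, homAct_ι, Category.assoc]

/-- The `E`-module `Hom_E(Y, Z)`. -/
def homMod (Y Z : EMod k E C) : EMod k E C :=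
  EMod.ofAct (homObj Y Z) (homAct Y Z)
    (homObj_hom_ext Y Z (by
      rw [homAct_ι]
      change _ ≫ (ihom Y.X).map (Z.act 1) = _
      rw [EMod.act_one]; simp))
    (fun a b => homObj_hom_ext Y Z (by
      rw [homAct_ι, Category.assoc, homAct_ι, homAct_ι_assoc]
      congr 1
      change (ihom Y.X).map (Z.act (a * b)) = (ihom Y.X).map (Z.act b) ≫ (ihom Y.X).map (Z.act a)
      rw [EMod.act_mul, Functor.map_comp]))

/-- Precomposition with a morphism of `E`-modules. -/
def homPre {Y Y' : EMod k E C} (f : Y ⟶ Y') (Z : EMod k E C) : homObj Y' Z ⟶ homObj Y Z :=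
  homLift Y Z (homι Y' Z ≫ (MonoidalClosed.pre f.hom).app Z.X) (fun e => by
    have h1 : (MonoidalClosed.pre f.hom).app Z.X ≫ ihomActSource Y Z e =
        ihomActSource Y' Z e ≫ (MonoidalClosed.pre f.hom).app Z.X := by
      change (MonoidalClosed.pre f.hom).app Z.X ≫ (MonoidalClosed.pre (Y.act e)).app Z.X =
        (MonoidalClosed.pre (Y'.act e)).app Z.X ≫ (MonoidalClosed.pre f.hom).app Z.X
      rw [← NatTrans.comp_app, ← NatTrans.comp_app, ← MonoidalClosed.pre_map,
        ← MonoidalClosed.pre_map, f.comm]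
    have h2 : (MonoidalClosed.pre f.hom).app Z.X ≫ ihomActTarget Y Z e =
        ihomActTarget Y' Z e ≫ (MonoidalClosed.pre f.hom).app Z.X :=
      ((MonoidalClosed.pre f.hom).naturality (Z.act e)).symm
    rw [Category.assoc, Category.assoc, h1, h2, ← Category.assoc, hom_condition, Category.assoc])

@[simp]
theorem homPre_ι {Y Y' : EMod k E C} (f : Y ⟶ Y') (Z : EMod k E C) :
    homPre f Z ≫ homι Y Z = homι Y' Z ≫ (MonoidalClosed.pre f.hom).app Z.X :=
  homLift_ι _ _ _ _

theorem homPre_ι_assoc {Y Y' : EMod k E C} (f : Y ⟶ Y') (Z : EMod k E C) {V : C}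
    (g : (ihom Y.X).obj Z.X ⟶ V) :
    homPre f Z ≫ homι Y Z ≫ g = homι Y' Z ≫ (MonoidalClosed.pre f.hom).app Z.X ≫ g := by
  rw [← Category.assoc, homPre_ι, Category.assoc]

/-- The contravariant functor `Y ↦ Hom_E(Y, Z)` from `E`-modules to `E`-modules. -/
def homFunctor (Z : EMod k E C) : (EMod k E C)ᵒᵖ ⥤ EMod k E C where
  obj Y := homMod Y.unop Z
  map {Y' Y} f :=
    { hom := homPre f.unop Z
      comm := fun e => homObj_hom_ext Y.unop Z (by
        change (homAct _ Z e ≫ homPre f.unop Z) ≫ _ = (homPre f.unop Z ≫ homAct _ Z e) ≫ _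
        rw [Category.assoc, homPre_ι, homAct_ι_assoc, Category.assoc, homAct_ι, homPre_ι_assoc]
        congr 1
        exact (MonoidalClosed.pre f.unop.hom).naturality (Z.act e)) }
  map_id Y := EMod.hom_ext (homObj_hom_ext Y.unop Z (by
    change homPre (𝟙 Y.unop) Z ≫ homι _ Z = 𝟙 (homObj Y.unop Z) ≫ homι _ Z
    rw [homPre_ι]; simp))
  map_comp {Y Y' Y''} f g := EMod.hom_ext (homObj_hom_ext Y''.unop Z (by
    change homPre (g.unop ≫ f.unop) Z ≫ homι _ Z =
      (homPre f.unop Z ≫ homPre g.unop Z) ≫ homι _ Z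
    rw [homPre_ι, Category.assoc, homPre_ι, homPre_ι_assoc, EMod.comp_hom,
      MonoidalClosed.pre_map]
    simp))

end InternalHom

end LinCat

end

/-! Let Z carry two commuting actions of E. The maps E ⊗ E ⊗ Z → E ⊗ Z → Z (`barD₂`, `barD₁`) begin
its Hochschild complex. H₀ is the largest quotient of Z on which the actions agree: it is M ⊗_E X
for Z = M ⊗ X, and Y ⊗_E X for Z = Y ⊗ X (`extπ_isCoinvariants`, `tensorπ_isCoinvariants`). H₁ plays
the role of Tor₁, and `BarExact` says that it vanishes. Two fragments of the long exact sequence are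
needed: `mono_of_barExact` and `BarExact.of_shortExact`.

Flat implies exact. Right exactness of − ⊗_E X is formal, so the point is that monomorphisms A → B
are preserved. Write S = E/nil(E). Flatness gives H₁(S ⊗ X) = 0, by comparison with the free module
E, whose bar complex has a contracting homotopy. If the cokernel Q of A → B is killed by the
nilradical, then Q is an S-module, and a separability idempotent of S makes Q ⊗ X a direct summand
of Q ⊗ (S ⊗ X), compatibly with both actions. Since Q ⊗ − is exact, H₁(Q ⊗ X) = 0
(`barExact_tensor`), so A ⊗_E X → B ⊗_E X is mono. A general monomorphism is a composite of such
ones, because elements of the nilradical are nilpotent and E is Noetherian (`EMod.mono_induction`).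

Exact implies flat. M ⊗_E X is (M ⊗ 𝟙) ⊗_E X, and M ↦ M ⊗ 𝟙 is exact (`extFunctorIso`,
`copowerModFunctor_exact`).

Duality. In the rigid case Hom_E(Y, X^∨) is naturally the dual of Y ⊗_E X (`homFunctorIso`), and
duals form a contravariant equivalence, so (b) and (c) are equivalent. -/

noncomputable section

namespace LinCat

attribute [local instance] Abelian.hasFiniteBiproducts

namespace EMod

variable {k : Type*} [Field k] {E : Type w} [CommRing E] [Algebra k E]
variable {C : Type u} [Category.{v} C] [Abelian C] [Linear k C]

/-! ### The category of `E`-modules is abelian -/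

/-- Build a morphism of `E`-modules. -/
def mkHom {M N : EMod k E C} (f : M.X ⟶ N.X) (h : ∀ e : E, M.act e ≫ f = f ≫ N.act e) : M ⟶ N :=
  ⟨f, h⟩

theorem hom_comm {M N : EMod k E C} (f : M ⟶ N) (e : E) :
    M.act e ≫ f.hom = f.hom ≫ N.act e := f.comm e

instance (M N : EMod k E C) : Add (M ⟶ N) where
  add f g := mkHom (f.hom + g.hom) fun e => by
    rw [Preadditive.comp_add, Preadditive.add_comp, hom_comm, hom_comm]

instance (M N : EMod k E C) : Zero (M ⟶ N) where
  zero := mkHom 0 fun e => by simp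

instance (M N : EMod k E C) : Neg (M ⟶ N) where
  neg f := mkHom (-f.hom) fun e => by
    rw [Preadditive.comp_neg, Preadditive.neg_comp, hom_comm]

instance (M N : EMod k E C) : AddCommGroup (M ⟶ N) where
  add_assoc f g h := hom_ext (add_assoc f.hom g.hom h.hom)
  zero_add f := hom_ext (zero_add f.hom)
  add_zero f := hom_ext (add_zero f.hom)
  add_comm f g := hom_ext (add_comm f.hom g.hom)
  neg_add_cancel f := hom_ext (neg_add_cancel f.hom)
  nsmul := nsmulRec
  zsmul := zsmulRec

@[simp]
theorem add_hom {M N : EMod k E C} (f g : M ⟶ N) : (f + g).hom = f.hom + g.hom := rfl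

instance : Preadditive (EMod k E C) where
  add_comp _ _ _ f f' g := hom_ext (Preadditive.add_comp _ _ _ f.hom f'.hom g.hom)
  comp_add _ _ _ f g g' := hom_ext (Preadditive.comp_add _ _ _ f.hom g.hom g'.hom)

variable (k E C) in
/-- The forgetful functor from `E`-modules to the underlying category. -/
def forget : EMod k E C ⥤ C where
  obj M := M.X
  map f := f.hom

instance : (forget k E C).Additive where

instance : (forget k E C).ReflectsIsomorphisms where
  reflects {M N} f hf := by
    change IsIso f.hom at hf
    refine ⟨mkHom (inv f.hom) fun e => ?_, hom_ext (IsIso.hom_inv_id f.hom),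
      hom_ext (IsIso.inv_hom_id f.hom)⟩
    rw [IsIso.comp_inv_eq, Category.assoc, hom_comm, IsIso.inv_hom_id_assoc]

theorem hom_comp_eq_zero {M N P : EMod k E C} {f : M ⟶ N} {g : N ⟶ P} (h : f ≫ g = 0) :
    f.hom ≫ g.hom = 0 := congrArg Hom.hom h

/-- The action of `E` on the kernel of a morphism of `E`-modules. -/
def kernelAct {M N : EMod k E C} (f : M ⟶ N) : E →ₗ[k] (kernel f.hom ⟶ kernel f.hom) where
  toFun e := kernel.lift f.hom (kernel.ι f.hom ≫ M.act e) (by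
    rw [Category.assoc, hom_comm, kernel.condition_assoc, zero_comp])
  map_add' a b := by ext; simp [Preadditive.comp_add, Preadditive.add_comp]
  map_smul' c a := by ext; simp

theorem kernelAct_ι {M N : EMod k E C} (f : M ⟶ N) (e : E) :
    kernelAct f e ≫ kernel.ι f.hom = kernel.ι f.hom ≫ M.act e := kernel.lift_ι _ _ _

theorem kernelAct_ι_assoc {M N : EMod k E C} (f : M ⟶ N) (e : E) {Z : C} (h : M.X ⟶ Z) :
    kernelAct f e ≫ kernel.ι f.hom ≫ h = kernel.ι f.hom ≫ M.act e ≫ h := by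
  simpa only [Category.assoc] using (kernelAct_ι f e) =≫ h

/-- The kernel of a morphism of `E`-modules. -/
def kernelMod {M N : EMod k E C} (f : M ⟶ N) : EMod k E C :=
  ofAct (kernel f.hom) (kernelAct f)
    (by ext; simp [act_one, kernelAct_ι])
    (fun x y => by ext; simp [act_mul, kernelAct_ι, kernelAct_ι_assoc])

/-- The inclusion of the kernel of a morphism of `E`-modules. -/
def kernelModι {M N : EMod k E C} (f : M ⟶ N) : kernelMod f ⟶ M :=
  mkHom (kernel.ι f.hom) (kernelAct_ι f)

theorem kernelModι_comp {M N : EMod k E C} (f : M ⟶ N) : kernelModι f ≫ f = 0 :=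
  hom_ext (kernel.condition f.hom)

/-- The universal property of the kernel of a morphism of `E`-modules. -/
def kernelModIsLimit {M N : EMod k E C} (f : M ⟶ N) :
    IsLimit (KernelFork.ofι (kernelModι f) (kernelModι_comp f)) :=
  KernelFork.IsLimit.ofι _ _
    (fun {W} g hg => mkHom (kernel.lift f.hom g.hom (hom_comp_eq_zero hg)) fun e => by
      have : W.act e ≫ kernel.lift f.hom g.hom (hom_comp_eq_zero hg) =
          kernel.lift f.hom g.hom (hom_comp_eq_zero hg) ≫ kernelAct f e := by
        rw [← cancel_mono (kernel.ι f.hom), Category.assoc, Category.assoc, kernel.lift_ι,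
          kernelAct_ι, kernel.lift_ι_assoc, hom_comm]
      exact this)
    (fun g hg => hom_ext (kernel.lift_ι _ _ _))
    (fun g hg m hm => hom_ext ((cancel_mono (kernel.ι f.hom)).1
      ((congrArg Hom.hom hm).trans (kernel.lift_ι _ _ _).symm)))

/-- The action of `E` on the cokernel of a morphism of `E`-modules. -/
def cokernelAct {M N : EMod k E C} (f : M ⟶ N) : E →ₗ[k] (cokernel f.hom ⟶ cokernel f.hom) where
  toFun e := cokernel.desc f.hom (N.act e ≫ cokernel.π f.hom) (by
    rw [← Category.assoc, ← hom_comm, Category.assoc, cokernel.condition, comp_zero])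
  map_add' a b := by ext; simp [Preadditive.comp_add, Preadditive.add_comp]
  map_smul' c a := by ext; simp

theorem π_cokernelAct {M N : EMod k E C} (f : M ⟶ N) (e : E) :
    cokernel.π f.hom ≫ cokernelAct f e = N.act e ≫ cokernel.π f.hom := cokernel.π_desc _ _ _

theorem π_cokernelAct_assoc {M N : EMod k E C} (f : M ⟶ N) (e : E) {Z : C}
    (h : cokernel f.hom ⟶ Z) :
    cokernel.π f.hom ≫ cokernelAct f e ≫ h = N.act e ≫ cokernel.π f.hom ≫ h := by
  simpa only [Category.assoc] using (π_cokernelAct f e) =≫ h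

/-- The cokernel of a morphism of `E`-modules. -/
def cokernelMod {M N : EMod k E C} (f : M ⟶ N) : EMod k E C :=
  ofAct (cokernel f.hom) (cokernelAct f)
    (by ext; simp [act_one, π_cokernelAct])
    (fun x y => by ext; simp [act_mul, π_cokernelAct, π_cokernelAct_assoc])

/-- The projection to the cokernel of a morphism of `E`-modules. -/
def cokernelModπ {M N : EMod k E C} (f : M ⟶ N) : N ⟶ cokernelMod f :=
  mkHom (cokernel.π f.hom) fun e => (π_cokernelAct f e).symm

theorem comp_cokernelModπ {M N : EMod k E C} (f : M ⟶ N) : f ≫ cokernelModπ f = 0 :=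
  hom_ext (cokernel.condition f.hom)

/-- The universal property of the cokernel of a morphism of `E`-modules. -/
def cokernelModIsColimit {M N : EMod k E C} (f : M ⟶ N) :
    IsColimit (CokernelCofork.ofπ (cokernelModπ f) (comp_cokernelModπ f)) :=
  CokernelCofork.IsColimit.ofπ _ _
    (fun {W} g hg => mkHom (cokernel.desc f.hom g.hom (hom_comp_eq_zero hg)) fun e => by
      have : cokernelAct f e ≫ cokernel.desc f.hom g.hom (hom_comp_eq_zero hg) =
          cokernel.desc f.hom g.hom (hom_comp_eq_zero hg) ≫ W.act e := by
        rw [← cancel_epi (cokernel.π f.hom), π_cokernelAct_assoc, cokernel.π_desc,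
          cokernel.π_desc_assoc, hom_comm]
      exact this)
    (fun g hg => hom_ext (cokernel.π_desc _ _ _))
    (fun g hg m hm => hom_ext ((cancel_epi (cokernel.π f.hom)).1
      ((congrArg Hom.hom hm).trans (cokernel.π_desc _ _ _).symm)))

instance : HasKernels (EMod k E C) where
  has_limit f := ⟨⟨⟨_, kernelModIsLimit f⟩⟩⟩

instance : HasCokernels (EMod k E C) where
  has_colimit f := ⟨⟨⟨_, cokernelModIsColimit f⟩⟩⟩

instance {M N : EMod k E C} (f : M ⟶ N) :
    PreservesLimit (parallelPair f 0) (forget k E C) :=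
  preservesLimit_of_preserves_limit_cone (kernelModIsLimit f)
    ((KernelFork.isLimitMapConeEquiv _ (forget k E C)).2 (kernelIsKernel f.hom))

instance {M N : EMod k E C} (f : M ⟶ N) :
    PreservesColimit (parallelPair f 0) (forget k E C) :=
  preservesColimit_of_preserves_colimit_cocone (cokernelModIsColimit f)
    ((CokernelCofork.isColimitMapCoconeEquiv _ (forget k E C)).2 (cokernelIsCokernel f.hom))

/-- The biproduct of two `E`-modules. -/
def biprodMod (M N : EMod k E C) : EMod k E C :=
  ofAct (M.X ⊞ N.X)
    { toFun e := biprod.map (M.act e) (N.act e)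
      map_add' a b := by
        ext <;> simp [Preadditive.comp_add, Preadditive.add_comp]
      map_smul' c a := by ext <;> simp }
    (by ext <;> simp [act_one])
    (fun x y => by ext <;> simp [act_mul])

instance : HasBinaryBiproducts (EMod k E C) where
  has_binary_biproduct M N := hasBinaryBiproduct_of_total
    { pt := biprodMod M N
      fst := mkHom biprod.fst fun _ => biprod.map_fst _ _
      snd := mkHom biprod.snd fun _ => biprod.map_snd _ _
      inl := mkHom biprod.inl fun _ => (biprod.inl_map _ _).symm
      inr := mkHom biprod.inr fun _ => (biprod.inr_map _ _).symm
      inl_fst := hom_ext biprod.inl_fst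
      inl_snd := hom_ext biprod.inl_snd
      inr_fst := hom_ext biprod.inr_fst
      inr_snd := hom_ext biprod.inr_snd }
    (hom_ext biprod.total)

instance : HasZeroObject (EMod k E C) where
  zero := by
    obtain ⟨Z₀, hZ₀⟩ := HasZeroObject.zero (C := C)
    let Z : EMod k E C := ofAct Z₀ 0 (hZ₀.eq_of_src _ _) (by simp)
    exact ⟨Z, (IsZero.iff_id_eq_zero Z).2 (hom_ext (hZ₀.eq_of_src _ _))⟩

instance : HasFiniteProducts (EMod k E C) := hasFiniteProducts_of_has_binary_and_terminal

/-- The forgetful functor preserves kernels and cokernels, so it carries this comparison to the one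
in `C`, which is invertible; it also reflects isomorphisms. -/
instance {M N : EMod k E C} (f : M ⟶ N) : IsIso (Abelian.coimageImageComparison f) :=
  have := IsIso.of_isIso_fac_right (Abelian.PreservesCoimage.hom_coimageImageComparison
    (forget k E C) f).symm
  isIso_of_reflects_iso _ (forget k E C)

instance : Abelian (EMod k E C) := Abelian.ofCoimageImageComparisonIsIso

instance : PreservesFiniteLimits (forget k E C) :=
  have : ∀ ⦃M N : EMod k E C⦄ (f : M ⟶ N), PreservesLimit (parallelPair f 0) (forget k E C) :=
    fun _ _ _ => inferInstance
  ((forget k E C).preservesFiniteLimits_tfae.out 2 3).1 this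

instance : PreservesFiniteColimits (forget k E C) :=
  have : ∀ ⦃M N : EMod k E C⦄ (f : M ⟶ N), PreservesColimit (parallelPair f 0) (forget k E C) :=
    fun _ _ _ => inferInstance
  ((forget k E C).preservesFiniteColimits_tfae.out 2 3).1 this

/-- Exactness of a functor to `E`-modules can be checked on underlying objects. -/
theorem exactFunctor_iff_comp_forget {D : Type*} [Category* D] (F : D ⥤ EMod k E C) :
    exactFunctor D (EMod k E C) F ↔ exactFunctor D C (F ⋙ forget k E C) := by
  rw [exactFunctor_iff, exactFunctor_iff]
  constructor
  · rintro ⟨h1, h2⟩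
    exact ⟨comp_preservesFiniteLimits _ _, comp_preservesFiniteColimits _ _⟩
  · rintro ⟨h1, h2⟩
    have := h1.preservesFiniteLimits
    have := h2.preservesFiniteColimits
    refine ⟨⟨fun J _ _ => ?_⟩, ⟨fun J _ _ => ?_⟩⟩
    -- A functor that preserves limits existing in its source and reflects isomorphisms also
    -- reflects those limits.
    · have : ReflectsLimitsOfShape J (forget k E C) :=
        reflectsLimitsOfShape_of_reflectsIsomorphisms
      exact preservesLimitsOfShape_of_reflects_of_preserves F (forget k E C)
    · have : ReflectsColimitsOfShape J (forget k E C) :=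
        reflectsColimitsOfShape_of_reflectsIsomorphisms
      exact preservesColimitsOfShape_of_reflects_of_preserves F (forget k E C)

end EMod

/-! ### Functoriality and exactness of `V ⊗ X` -/

section CopowerFunctoriality

variable {k : Type*} [Field k] {C : Type u} [Category.{v} C] [Abelian C] [Linear k C]
variable {V : Type*} [AddCommGroup V] [Module k V] [Module.Finite k V]
variable {W : Type*} [AddCommGroup W] [Module k W] [Module.Finite k W]
variable {U : Type*} [AddCommGroup U] [Module k U] [Module.Finite k U]

theorem ι_copowerDesc {X Y : C} (φ : V →ₗ[k] (X ⟶ Y)) (x : V) :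
    copowerι k V X x ≫ copowerDesc φ = φ x := copowerι_desc φ x

theorem ι_copowerDesc_assoc {X Y : C} (φ : V →ₗ[k] (X ⟶ Y)) (x : V) {Z : C} (h : Y ⟶ Z) :
    copowerι k V X x ≫ copowerDesc φ ≫ h = φ x ≫ h := by
  simpa only [Category.assoc] using (ι_copowerDesc φ x) =≫ h

theorem ι_copowerMap (g : V →ₗ[k] W) (X : C) (x : V) :
    copowerι k V X x ≫ copowerMap g X = copowerι k W X (g x) := copowerι_map g X x

theorem ι_copowerMap_assoc (g : V →ₗ[k] W) (X : C) (x : V) {Z : C}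
    (h : copower k W X ⟶ Z) :
    copowerι k V X x ≫ copowerMap g X ≫ h = copowerι k W X (g x) ≫ h := by
  simpa only [Category.assoc] using (ι_copowerMap g X x) =≫ h

theorem copowerMap_id (X : C) : copowerMap (LinearMap.id : V →ₗ[k] V) X = 𝟙 _ :=
  copower_hom_ext fun x => by rw [ι_copowerMap, Category.comp_id]; rfl

theorem copowerMap_comp (g : V →ₗ[k] W) (h : W →ₗ[k] U) (X : C) :
    copowerMap g X ≫ copowerMap h X = copowerMap (h ∘ₗ g) X :=
  copower_hom_ext fun x => by rw [ι_copowerMap_assoc, ι_copowerMap, ι_copowerMap]; rfl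

theorem copowerMap_add (g h : V →ₗ[k] W) (X : C) :
    copowerMap (g + h) X = copowerMap g X + copowerMap h X :=
  copower_hom_ext fun x => by
    simp only [Preadditive.comp_add, ι_copowerMap, LinearMap.add_apply, map_add]

theorem copowerMap_zero (X : C) : copowerMap (0 : V →ₗ[k] W) X = 0 :=
  copower_hom_ext fun x => by simp [ι_copowerMap]

/-- `V ⊗ X` takes short exact sequences of vector spaces to short exact sequences. -/
theorem copowerMap_shortExact {f : V →ₗ[k] W} {g : W →ₗ[k] U} (hf : Function.Injective f)
    (hg : Function.Surjective g) (h : Function.Exact f g) (X : C) :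
    (ShortComplex.mk (copowerMap f X) (copowerMap g X) (by
      rw [copowerMap_comp, h.linearMap_comp_eq_zero, copowerMap_zero])).ShortExact := by
  obtain ⟨r₀, hr₀⟩ := f.exists_leftInverse_of_injective (LinearMap.ker_eq_bot.2 hf)
  obtain ⟨s, hs⟩ := g.exists_rightInverse_of_surjective (LinearMap.range_eq_top.2 hg)
  have hr₀' : ∀ x, r₀ (f x) = x := LinearMap.congr_fun hr₀
  have hs' : ∀ x, g (s x) = x := LinearMap.congr_fun hs
  have hgf : ∀ x, g (f x) = 0 := h.apply_apply_eq_zero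
  -- The retraction is corrected so as to vanish on the image of `s`: `y - s (g y)` lies in the
  -- image of `f`, and `r y` is its preimage. This gives the splitting identity.
  let r : W →ₗ[k] V := r₀ ∘ₗ (LinearMap.id - s ∘ₗ g)
  refine ShortComplex.Splitting.shortExact
    { r := copowerMap r X
      s := copowerMap s X
      f_r := ?_
      s_g := ?_
      id := ?_ }
  · dsimp only
    rw [copowerMap_comp, ← copowerMap_id]
    congr 1
    ext x
    simp [r, hgf, hr₀']
  · dsimp only
    rw [copowerMap_comp, ← copowerMap_id, hs]
  · change copowerMap r X ≫ copowerMap f X + copowerMap g X ≫ copowerMap s X = 𝟙 _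
    have e1 := copowerMap_comp r f X
    have e2 := copowerMap_comp g s X
    rw [e1, e2, ← copowerMap_add, ← copowerMap_id]
    congr 1
    ext y
    obtain ⟨z, hz⟩ : ∃ z, f z = y - s (g y) := (h _).1 (by simp [hs'])
    simp only [r, LinearMap.add_apply, LinearMap.comp_apply, LinearMap.sub_apply, LinearMap.id_apply]
    rw [← hz, hr₀', hz, sub_add_cancel]


variable (k V) in
/-- Functoriality of `V ⊗ X` in `X`. -/
def copowerObjMap {X Y : C} (f : X ⟶ Y) : copower k V X ⟶ copower k V Y :=
  copowerDesc ((Linear.leftComp k _ f).comp (copowerι k V Y))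

theorem ι_copowerObjMap {X Y : C} (f : X ⟶ Y) (x : V) :
    copowerι k V X x ≫ copowerObjMap k V f = f ≫ copowerι k V Y x :=
  copowerι_desc _ x

theorem ι_copowerObjMap_assoc {X Y : C} (f : X ⟶ Y) (x : V) {Z : C} (h : copower k V Y ⟶ Z) :
    copowerι k V X x ≫ copowerObjMap k V f ≫ h = f ≫ copowerι k V Y x ≫ h := by
  simpa only [Category.assoc] using (ι_copowerObjMap f x) =≫ h

theorem copowerObjMap_comp {X Y Z : C} (f : X ⟶ Y) (g : Y ⟶ Z) :
    copowerObjMap k V f ≫ copowerObjMap k V g = copowerObjMap k V (f ≫ g) :=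
  copower_hom_ext fun x => by
    rw [ι_copowerObjMap_assoc, ι_copowerObjMap, ι_copowerObjMap, Category.assoc]

theorem copowerObjMap_id (X : C) : copowerObjMap k V (𝟙 X) = 𝟙 _ :=
  copower_hom_ext fun x => by simp [ι_copowerObjMap]

theorem copowerObjMap_map {X Y : C} (f : X ⟶ Y) (g : V →ₗ[k] W) :
    copowerMap g X ≫ copowerObjMap k W f = copowerObjMap k V f ≫ copowerMap g Y :=
  copower_hom_ext fun x => by
    rw [ι_copowerMap_assoc, ι_copowerObjMap, ι_copowerObjMap_assoc, ι_copowerMap]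

/-- The coordinate `V ⊗ X ⟶ X` given by a linear form on `V`. -/
def copowerCoord (ξ : Module.Dual k V) (X : C) : copower k V X ⟶ X :=
  copowerDesc ((LinearMap.toSpanSingleton k (X ⟶ X) (𝟙 X)).comp ξ)

theorem ι_copowerCoord (ξ : Module.Dual k V) (X : C) (x : V) :
    copowerι k V X x ≫ copowerCoord ξ X = ξ x • 𝟙 X :=
  copowerι_desc _ x

theorem ι_copowerCoord_assoc (ξ : Module.Dual k V) (X : C) (x : V) {Z : C} (h : X ⟶ Z) :
    copowerι k V X x ≫ copowerCoord ξ X ≫ h = (ξ x • 𝟙 X) ≫ h := by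
  simpa only [Category.assoc] using (ι_copowerCoord ξ X x) =≫ h

theorem copowerObjMap_coord {X Y : C} (f : X ⟶ Y) (ξ : Module.Dual k V) :
    copowerObjMap k V f ≫ copowerCoord ξ Y = copowerCoord ξ X ≫ f :=
  copower_hom_ext fun x => by
    rw [ι_copowerObjMap_assoc, ι_copowerCoord, ι_copowerCoord_assoc]; simp

-- This finite decomposition of the identity is what additive functors preserve, and it allows
-- morphisms into V ⊗ X to be assembled from coordinates.
variable (k V) in
theorem copower_total (X : C) :
    ∑ i, copowerCoord ((Module.finBasis k V).coord i) X ≫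
      copowerι k V X (Module.finBasis k V i) = 𝟙 (copower k V X) :=
  copower_hom_ext fun x => by
    simp only [Preadditive.comp_sum, ι_copowerCoord_assoc, Linear.smul_comp, Category.id_comp,
      Category.comp_id]
    conv_rhs => rw [← (Module.finBasis k V).sum_repr x, map_sum]
    simp

instance copowerObjMap_epi {X Y : C} (f : X ⟶ Y) [Epi f] : Epi (copowerObjMap k V f) where
  left_cancellation g h hgh := copower_hom_ext fun x => by
    rw [← cancel_epi f, ← ι_copowerObjMap_assoc, hgh, ι_copowerObjMap_assoc]

/-- Left exactness of V ⊗ − in the form used by diagram chases: each coordinate of `x` is killed by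
`S.g`, hence lifts along `S.f`, and the lifts are recombined by `copower_total`. -/
theorem exists_lift_copowerObjMap {S : ShortComplex C} (hS : S.ShortExact) {T : C}
    (x : T ⟶ copower k V S.X₂) (hx : x ≫ copowerObjMap k V S.g = 0) :
    ∃ y : T ⟶ copower k V S.X₁, y ≫ copowerObjMap k V S.f = x := by
  have := hS.mono_f
  have h0 : ∀ ξ : Module.Dual k V, (x ≫ copowerCoord ξ S.X₂) ≫ S.g = 0 := fun ξ => by
    rw [Category.assoc, ← copowerObjMap_coord, ← Category.assoc, hx, zero_comp]
  refine ⟨∑ i, hS.exact.lift _ (h0 ((Module.finBasis k V).coord i)) ≫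
    copowerι k V S.X₁ (Module.finBasis k V i), ?_⟩
  simp only [Preadditive.sum_comp, Category.assoc, ι_copowerObjMap]
  simp only [← Category.assoc, ShortComplex.Exact.lift_f]
  simp only [Category.assoc, ← Preadditive.comp_sum, copower_total, Category.comp_id]

end CopowerFunctoriality

/-! ### Linear functors commute with `V ⊗ X` -/

section LinearFunctor

variable {k : Type*} [Field k] {C : Type u} [Category.{v} C] [Abelian C] [Linear k C]
variable {V : Type*} [AddCommGroup V] [Module k V] [Module.Finite k V]
variable (G : C ⥤ C) [G.Additive] [G.Linear k]

variable {G} in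
/-- The morphism `G(V ⊗ X) ⟶ Y` corresponding to a linear map `V → Hom(G X, Y)`. -/
def mapCopowerDesc {X Y : C} (φ : V →ₗ[k] (G.obj X ⟶ Y)) : G.obj (copower k V X) ⟶ Y :=
  ∑ i, G.map (copowerCoord ((Module.finBasis k V).coord i) X) ≫ φ (Module.finBasis k V i)

omit [G.Additive] in
theorem map_ι_mapCopowerDesc {X Y : C} (φ : V →ₗ[k] (G.obj X ⟶ Y)) (x : V) :
    G.map (copowerι k V X x) ≫ mapCopowerDesc φ = φ x := by
  simp only [mapCopowerDesc, Preadditive.comp_sum, ← G.map_comp_assoc, ι_copowerCoord,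
    G.map_smul, G.map_id, Linear.smul_comp, Category.id_comp]
  conv_rhs => rw [← (Module.finBasis k V).sum_repr x, map_sum]
  simp

omit [G.Additive] in
theorem map_ι_mapCopowerDesc_assoc {X Y : C} (φ : V →ₗ[k] (G.obj X ⟶ Y)) (x : V) {Z : C}
    (h : Y ⟶ Z) :
    G.map (copowerι k V X x) ≫ mapCopowerDesc φ ≫ h = φ x ≫ h := by
  simpa only [Category.assoc] using (map_ι_mapCopowerDesc G φ x) =≫ h

-- Additivity suffices, since G preserves the decomposition `copower_total` of the identity.
variable {G} in
omit [G.Linear k] in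
theorem map_copower_hom_ext {X Y : C} {f g : G.obj (copower k V X) ⟶ Y}
    (h : ∀ x : V, G.map (copowerι k V X x) ≫ f = G.map (copowerι k V X x) ≫ g) : f = g := by
  rw [← Category.id_comp f, ← Category.id_comp g, ← G.map_id, ← copower_total k V, G.map_sum,
    Preadditive.sum_comp, Preadditive.sum_comp]
  simp only [G.map_comp, Category.assoc, h]

/-- The isomorphism `V ⊗ G(X) ≅ G(V ⊗ X)` for a linear functor `G`. -/
def copowerMapIso (V : Type*) [AddCommGroup V] [Module k V] [Module.Finite k V] (X : C) :
    copower k V (G.obj X) ≅ G.obj (copower k V X) where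
  hom := copowerDesc ((G.mapLinearMap k).comp (copowerι k V X))
  inv := mapCopowerDesc (copowerι k V (G.obj X))
  hom_inv_id := copower_hom_ext fun x => by
    rw [ι_copowerDesc_assoc, Category.comp_id]
    exact map_ι_mapCopowerDesc G _ x
  inv_hom_id := map_copower_hom_ext fun x => by
    rw [map_ι_mapCopowerDesc_assoc, Category.comp_id, ι_copowerDesc]
    rfl

theorem ι_copowerMapIso_hom (X : C) (x : V) :
    copowerι k V (G.obj X) x ≫ (copowerMapIso (k := k) G V X).hom = G.map (copowerι k V X x) :=
  ι_copowerDesc _ x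

theorem ι_copowerMapIso_hom_assoc (X : C) (x : V) {Z : C} (h : G.obj (copower k V X) ⟶ Z) :
    copowerι k V (G.obj X) x ≫ (copowerMapIso (k := k) G V X).hom ≫ h =
      G.map (copowerι k V X x) ≫ h := by
  simpa only [Category.assoc] using (ι_copowerMapIso_hom G X x) =≫ h

end LinearFunctor

/-! ### The bar complex of an object with two commuting actions -/

section Bar

open scoped TensorProduct

variable {k : Type*} [Field k] {E : Type w} [CommRing E] [Algebra k E] [Module.Finite k E]
variable {C : Type u} [Category.{v} C] [Abelian C] [Linear k C]

/-- Two commuting multiplicative actions of `E` on an object. -/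
structure CommutingActions {Z : C} (l r : E →ₗ[k] (Z ⟶ Z)) : Prop where
  left_mul : ∀ a b, l (a * b) = l a ≫ l b
  right_mul : ∀ a b, r (a * b) = r a ≫ r b
  comm : ∀ a b, l a ≫ r b = r b ≫ l a

/-- The differential `E ⊗ Z ⟶ Z`, whose cokernel is the largest quotient of `Z` on which the two
actions agree. -/
def barD₁ {Z : C} (l r : E →ₗ[k] (Z ⟶ Z)) : copower k E Z ⟶ Z := copowerDesc (l - r)

theorem ι_barD₁ {Z : C} (l r : E →ₗ[k] (Z ⟶ Z)) (e : E) :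
    copowerι k E Z e ≫ barD₁ l r = l e - r e := copowerι_desc _ _

theorem ι_barD₁_assoc {Z : C} (l r : E →ₗ[k] (Z ⟶ Z)) (e : E) {Y : C} (h : Z ⟶ Y) :
    copowerι k E Z e ≫ barD₁ l r ≫ h = (l e - r e) ≫ h := by
  simpa only [Category.assoc] using (ι_barD₁ l r e) =≫ h

/-- The differential `E ⊗ E ⊗ Z ⟶ E ⊗ Z`. -/
def barD₂ {Z : C} (l r : E →ₗ[k] (Z ⟶ Z)) : copower k (E ⊗[k] E) Z ⟶ copower k E Z :=
  copowerDesc (TensorProduct.lift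
    (LinearMap.mk₂ k (fun e f => l e ≫ copowerι k E Z f - copowerι k E Z (e * f) +
        r f ≫ copowerι k E Z e)
      (fun a b c => by
        simp only [map_add, add_mul, Preadditive.add_comp, Preadditive.comp_add]; abel)
      (fun c a b => by
        simp only [map_smul, Linear.smul_comp, Linear.comp_smul, smul_mul_assoc, smul_add,
          smul_sub])
      (fun a b c => by
        simp only [map_add, mul_add, Preadditive.add_comp, Preadditive.comp_add]; abel)
      (fun c a b => by
        simp only [map_smul, Linear.smul_comp, Linear.comp_smul, mul_smul_comm, smul_add,
          smul_sub])))

theorem ι_barD₂ {Z : C} (l r : E →ₗ[k] (Z ⟶ Z)) (e f : E) :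
    copowerι k (E ⊗[k] E) Z (e ⊗ₜ f) ≫ barD₂ l r =
      l e ≫ copowerι k E Z f - copowerι k E Z (e * f) + r f ≫ copowerι k E Z e :=
  (copowerι_desc _ _).trans (TensorProduct.lift.tmul _ _)

theorem ι_barD₂_assoc {Z : C} (l r : E →ₗ[k] (Z ⟶ Z)) (e f : E) {Y : C}
    (h : copower k E Z ⟶ Y) :
    copowerι k (E ⊗[k] E) Z (e ⊗ₜ f) ≫ barD₂ l r ≫ h =
      (l e ≫ copowerι k E Z f - copowerι k E Z (e * f) + r f ≫ copowerι k E Z e) ≫ h := by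
  simpa only [Category.assoc] using (ι_barD₂ l r e f) =≫ h

theorem copower_tensor_hom_ext {V W : Type*} [AddCommGroup V] [Module k V] [Module.Finite k V]
    [AddCommGroup W] [Module k W] [Module.Finite k W] {X Y : C}
    {f g : copower k (V ⊗[k] W) X ⟶ Y}
    (h : ∀ (x : V) (y : W), copowerι k (V ⊗[k] W) X (x ⊗ₜ y) ≫ f =
      copowerι k (V ⊗[k] W) X (x ⊗ₜ y) ≫ g) : f = g :=
  copower_hom_ext fun t => by
    induction t with
    | zero => simp
    | tmul x y => exact h x y
    | add a b ha hb => rw [map_add, Preadditive.add_comp, Preadditive.add_comp, ha, hb]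

/-- The mixed terms cancel because the two actions commute, the others by multiplicativity;
commutativity of E reconciles the orders of the products. -/
theorem CommutingActions.barD₂_barD₁ {Z : C} {l r : E →ₗ[k] (Z ⟶ Z)}
    (h : CommutingActions l r) : barD₂ l r ≫ barD₁ l r = 0 :=
  copower_tensor_hom_ext fun e f => by
    rw [ι_barD₂_assoc]
    simp only [Preadditive.add_comp, Preadditive.sub_comp, Category.assoc, ι_barD₁,
      Preadditive.comp_sub, h.left_mul, h.right_mul, h.comm, comp_zero]
    rw [← h.right_mul, ← h.right_mul, mul_comm f e]
    abel

/-- A morphism compatible with two actions induces a morphism of bar complexes in degree one. -/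
theorem barD₁_naturality {Z Z' : C} {l r : E →ₗ[k] (Z ⟶ Z)} {l' r' : E →ₗ[k] (Z' ⟶ Z')}
    {f : Z ⟶ Z'} (hl : ∀ e, l e ≫ f = f ≫ l' e) (hr : ∀ e, r e ≫ f = f ≫ r' e) :
    barD₁ l r ≫ f = copowerObjMap k E f ≫ barD₁ l' r' :=
  copower_hom_ext fun e => by
    rw [ι_barD₁_assoc, ι_copowerObjMap_assoc, ι_barD₁, Preadditive.sub_comp,
      Preadditive.comp_sub, hl, hr]

/-- A morphism compatible with two actions induces a morphism of bar complexes in degree two. -/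
theorem barD₂_naturality {Z Z' : C} {l r : E →ₗ[k] (Z ⟶ Z)} {l' r' : E →ₗ[k] (Z' ⟶ Z')}
    {f : Z ⟶ Z'} (hl : ∀ e, l e ≫ f = f ≫ l' e) (hr : ∀ e, r e ≫ f = f ≫ r' e) :
    barD₂ l r ≫ copowerObjMap k E f = copowerObjMap k (E ⊗[k] E) f ≫ barD₂ l' r' :=
  copower_tensor_hom_ext fun a b => by
    rw [ι_barD₂_assoc, ι_copowerObjMap_assoc, ι_barD₂]
    simp only [Preadditive.sub_comp, Preadditive.add_comp, Category.assoc, ι_copowerObjMap,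
      Preadditive.comp_sub, Preadditive.comp_add]
    rw [← Category.assoc (l a), ← Category.assoc (r b), hl, hr, Category.assoc, Category.assoc]

/-- The bar complex is exact in degree one. -/
def BarExact {Z : C} (l r : E →ₗ[k] (Z ⟶ Z)) : Prop :=
  ∀ ⦃T : C⦄ (x : T ⟶ copower k E Z), x ≫ barD₁ l r = 0 →
    ∃ (T' : C) (π : T' ⟶ T) (_ : Epi π) (y : T' ⟶ copower k (E ⊗[k] E) Z), π ≫ x = y ≫ barD₂ l r

/-- `p` is a cokernel of `barD₁`. -/
structure IsCoinvariants {Z H : C} (l r : E →ₗ[k] (Z ⟶ Z)) (p : Z ⟶ H) : Prop where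
  condition : ∀ e, l e ≫ p = r e ≫ p
  epi : Epi p
  exact : ∀ ⦃T : C⦄ (x : T ⟶ Z), x ≫ p = 0 →
    ∃ (T' : C) (π : T' ⟶ T) (_ : Epi π) (y : T' ⟶ copower k E Z), π ≫ x = y ≫ barD₁ l r

theorem IsCoinvariants.barD₁_comp {Z H : C} {l r : E →ₗ[k] (Z ⟶ Z)} {p : Z ⟶ H}
    (h : IsCoinvariants l r p) : barD₁ l r ≫ p = 0 :=
  copower_hom_ext fun e => by
    rw [ι_barD₁_assoc, Preadditive.sub_comp, h.condition, sub_self, comp_zero]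

/-- The universal property characterises coinvariants. -/
theorem IsCoinvariants.of_universal {Z H : C} {l r : E →ₗ[k] (Z ⟶ Z)} {p : Z ⟶ H}
    (hp : ∀ e, l e ≫ p = r e ≫ p)
    (desc : ∀ {W : C} (f : Z ⟶ W), (∀ e, l e ≫ f = r e ≫ f) → ∃ g : H ⟶ W, p ≫ g = f)
    (ext : ∀ {W : C} (f g : H ⟶ W), p ≫ f = p ≫ g → f = g) : IsCoinvariants l r p := by
  have h0 : barD₁ l r ≫ p = 0 := copower_hom_ext fun e => by
    rw [ι_barD₁_assoc, Preadditive.sub_comp, hp, sub_self, comp_zero]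
  have hd : ∀ {W : C} (f : Z ⟶ W), barD₁ l r ≫ f = 0 → ∃ g : H ⟶ W, p ≫ g = f := by
    intro W f hf
    refine desc f fun e => ?_
    rw [← sub_eq_zero, ← Preadditive.sub_comp, ← ι_barD₁, Category.assoc, hf, comp_zero]
  choose g hg using @hd
  have hex : (ShortComplex.mk (barD₁ l r) p h0).Exact :=
    ShortComplex.exact_of_g_is_cokernel _ (CokernelCofork.IsColimit.ofπ p h0
      (fun f hf => g f hf) (fun f hf => hg f hf)
      (fun f hf m hm => ext _ _ (hm.trans (hg f hf).symm)))
  exact ⟨hp, ⟨ext⟩, fun T x hx => hex.exact_up_to_refinements x hx⟩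

/-! ### Two fragments of the long exact homology sequence. -/

section Chase

variable {S : ShortComplex C} (hS : S.ShortExact)
variable {l₁ r₁ : E →ₗ[k] (S.X₁ ⟶ S.X₁)} {l₂ r₂ : E →ₗ[k] (S.X₂ ⟶ S.X₂)}
variable {l₃ r₃ : E →ₗ[k] (S.X₃ ⟶ S.X₃)}
variable (hfl : ∀ e, l₁ e ≫ S.f = S.f ≫ l₂ e) (hfr : ∀ e, r₁ e ≫ S.f = S.f ≫ r₂ e)
variable (hgl : ∀ e, l₂ e ≫ S.g = S.g ≫ l₃ e) (hgr : ∀ e, r₂ e ≫ S.g = S.g ≫ r₃ e)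

include hS hfl hfr hgl hgr

/-- This is the exactness of H₁(S₃) → H₀(S₁) → H₀(S₂), by a chase of generalised elements on
successive epimorphic covers. If a in S₁ dies in H₀(S₂), its image is d₁b. The image of b over S₃ is
a cycle, hence d₂q; lift q to c over S₂. Then b − d₂c comes from some d over S₁, and a = d₁d is zero
in H₀(S₁). -/
theorem mono_of_barExact (h₂ : CommutingActions l₂ r₂) (h₃ : BarExact l₃ r₃)
    {H₁ H₂ : C} {p₁ : S.X₁ ⟶ H₁} {p₂ : S.X₂ ⟶ H₂} (hp₁ : IsCoinvariants l₁ r₁ p₁)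
    (hp₂ : IsCoinvariants l₂ r₂ p₂) (φ : H₁ ⟶ H₂) (hφ : p₁ ≫ φ = S.f ≫ p₂) : Mono φ := by
  have := hS.mono_f
  have := hS.epi_g
  have := hp₁.epi
  refine Preadditive.mono_of_cancel_zero _ fun {T} t ht => ?_
  obtain ⟨T₁, π₁, _, a, ha⟩ := surjective_up_to_refinements_of_epi p₁ t
  obtain ⟨T₂, π₂, _, b, hb⟩ := hp₂.exact (a ≫ S.f) (by
    rw [Category.assoc, ← hφ, ← Category.assoc, ← ha, Category.assoc, ht, comp_zero])
  obtain ⟨T₃, π₃, _, q, hq⟩ := h₃ (b ≫ copowerObjMap k E S.g) (by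
    rw [Category.assoc, ← barD₁_naturality hgl hgr, ← Category.assoc, ← hb]
    simp)
  obtain ⟨T₄, π₄, _, c, hc⟩ :=
    surjective_up_to_refinements_of_epi (copowerObjMap k (E ⊗[k] E) S.g) q
  obtain ⟨d, hd⟩ := exists_lift_copowerObjMap hS (π₄ ≫ π₃ ≫ b - c ≫ barD₂ l₂ r₂) (by
    rw [Preadditive.sub_comp, Category.assoc, Category.assoc, hq, Category.assoc,
      barD₂_naturality hgl hgr, ← Category.assoc, ← Category.assoc, hc, sub_self])
  have key : π₄ ≫ π₃ ≫ π₂ ≫ a = d ≫ barD₁ l₁ r₁ := by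
    rw [← cancel_mono S.f, Category.assoc, Category.assoc, Category.assoc, hb, Category.assoc,
      barD₁_naturality hfl hfr, ← Category.assoc d, hd, Preadditive.sub_comp, Category.assoc,
      Category.assoc, Category.assoc, h₂.barD₂_barD₁, comp_zero, sub_zero]
  rw [← cancel_epi π₁, ← cancel_epi π₂, ← cancel_epi π₃, ← cancel_epi π₄, ha]
  simp only [comp_zero]
  have := key =≫ p₁
  simpa only [Category.assoc, hp₁.barD₁_comp, comp_zero] using this

/-- This is the exactness of H₁(S₂) → H₁(S₃) → H₀(S₁) → H₀(S₂). Lift a cycle m over S₃ to f over S₂.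
Then d₁f comes from S₁, where its class is killed by the monomorphism φ, so it is d₁a. Subtracting
the image of a turns f into a cycle, hence a boundary, still lifting m. -/
theorem BarExact.of_shortExact (h₂ : BarExact l₂ r₂)
    {H₁ H₂ : C} {p₁ : S.X₁ ⟶ H₁} {p₂ : S.X₂ ⟶ H₂} (hp₁ : IsCoinvariants l₁ r₁ p₁)
    (hp₂ : IsCoinvariants l₂ r₂ p₂) (φ : H₁ ⟶ H₂) (hφ : p₁ ≫ φ = S.f ≫ p₂) [Mono φ] :
    BarExact l₃ r₃ := by
  intro T m hm
  have := hS.mono_f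
  have := hS.epi_g
  obtain ⟨T₁, π₁, _, f, hf⟩ := surjective_up_to_refinements_of_epi (copowerObjMap k E S.g) m
  have h0 : (f ≫ barD₁ l₂ r₂) ≫ S.g = 0 := by
    rw [Category.assoc, barD₁_naturality hgl hgr, ← Category.assoc, ← hf, Category.assoc, hm,
      comp_zero]
  obtain ⟨T₂, π₂, _, a, ha⟩ := hp₁.exact (hS.exact.lift _ h0) (by
    rw [← cancel_mono φ, Category.assoc, hφ, hS.exact.lift_f_assoc, Category.assoc,
      hp₂.barD₁_comp, comp_zero, zero_comp])
  obtain ⟨T₃, π₃, _, c, hc⟩ := h₂ (π₂ ≫ f - a ≫ copowerObjMap k E S.f) (by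
    rw [Preadditive.sub_comp, Category.assoc, Category.assoc, ← barD₁_naturality hfl hfr,
      ← Category.assoc a, ← ha, Category.assoc, hS.exact.lift_f, sub_self])
  refine ⟨T₃, π₃ ≫ π₂ ≫ π₁, inferInstance, c ≫ copowerObjMap k (E ⊗[k] E) S.g, ?_⟩
  have h1 := hc =≫ copowerObjMap k E S.g
  rw [Category.assoc, Category.assoc, barD₂_naturality hgl hgr, Preadditive.sub_comp,
    Category.assoc, Category.assoc a, copowerObjMap_comp, S.zero] at h1
  have h2 : copowerObjMap k E (0 : S.X₁ ⟶ S.X₃) = 0 :=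
    copower_hom_ext fun e => by rw [ι_copowerObjMap]; simp
  rw [h2, comp_zero, sub_zero, ← hf] at h1
  simpa only [Category.assoc] using h1

end Chase

/-- Exactness of the bar complex passes to retracts. -/
theorem BarExact.of_retract {Z Z' : C} {l r : E →ₗ[k] (Z ⟶ Z)} {l' r' : E →ₗ[k] (Z' ⟶ Z')}
    (h : BarExact l' r') (s : Z ⟶ Z') (p : Z' ⟶ Z) (hsp : s ≫ p = 𝟙 Z)
    (hsl : ∀ e, l e ≫ s = s ≫ l' e) (hsr : ∀ e, r e ≫ s = s ≫ r' e)
    (hpl : ∀ e, l' e ≫ p = p ≫ l e) (hpr : ∀ e, r' e ≫ p = p ≫ r e) : BarExact l r := by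
  intro T x hx
  obtain ⟨T', π, hπ, y, hy⟩ := h (x ≫ copowerObjMap k E s) (by
    rw [Category.assoc, ← barD₁_naturality hsl hsr, ← Category.assoc, hx, zero_comp])
  refine ⟨T', π, hπ, y ≫ copowerObjMap k _ p, ?_⟩
  have := hy =≫ copowerObjMap k E p
  rw [Category.assoc, Category.assoc, Category.assoc, copowerObjMap_comp, hsp, copowerObjMap_id,
    Category.comp_id, barD₂_naturality hpl hpr] at this
  rw [this, Category.assoc]

/-- Exactness of the bar complex is preserved by exact linear functors. -/
theorem BarExact.map {Z : C} {l r : E →ₗ[k] (Z ⟶ Z)} (hc : CommutingActions l r)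
    (h : BarExact l r) (G : C ⥤ C)
    [G.Additive] [G.Linear k] [PreservesFiniteLimits G] [PreservesFiniteColimits G] :
    BarExact ((G.mapLinearMap k).comp l) ((G.mapLinearMap k).comp r) := by
  have hS : (ShortComplex.mk (barD₂ l r) (barD₁ l r) hc.barD₂_barD₁).Exact := by
    rw [ShortComplex.exact_iff_exact_up_to_refinements]
    exact h
  have hGS := hS.map G
  -- Through V ⊗ G(Z) ≅ G(V ⊗ Z), the image under G of the bar complex of Z becomes the bar complex
  -- of G(Z); `n₁` and `n₂` treat the two differentials.
  have n₁ : (copowerMapIso (k := k) G E Z).hom ≫ G.map (barD₁ l r) =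
      barD₁ ((G.mapLinearMap k).comp l) ((G.mapLinearMap k).comp r) :=
    copower_hom_ext fun e => by
      rw [ι_copowerMapIso_hom_assoc, ι_barD₁, ← G.map_comp, ι_barD₁, G.map_sub]; rfl
  have n₂ : (copowerMapIso (k := k) G (E ⊗[k] E) Z).hom ≫ G.map (barD₂ l r) =
      barD₂ ((G.mapLinearMap k).comp l) ((G.mapLinearMap k).comp r) ≫
        (copowerMapIso (k := k) G E Z).hom :=
    copower_tensor_hom_ext fun a b => by
      rw [ι_copowerMapIso_hom_assoc, ι_barD₂_assoc, ← G.map_comp, ι_barD₂]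
      simp only [Preadditive.add_comp, Preadditive.sub_comp, Category.assoc, ι_copowerMapIso_hom,
        G.map_add, G.map_sub, G.map_comp]
      rfl
  intro T x hx
  rw [← n₁, ← Category.assoc] at hx
  obtain ⟨T', π, hπ, (y : T' ⟶ G.obj (copower k (E ⊗[k] E) Z)),
    (hy : _ = y ≫ G.map (barD₂ l r))⟩ := hGS.exact_up_to_refinements _ hx
  refine ⟨T', π, hπ, y ≫ (copowerMapIso (k := k) G (E ⊗[k] E) Z).inv, ?_⟩
  rw [← cancel_mono (copowerMapIso (k := k) G E Z).hom, Category.assoc, Category.assoc,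
    Category.assoc, ← n₂, Iso.inv_hom_id_assoc]
  exact hy

end Bar

/-! ### The object `M ⊗ X` with its two actions -/

section ModuleCopower

open scoped ModuleCat TensorProduct

variable {k : Type*} [Field k] {E : Type w} [CommRing E] [Algebra k E]
variable {C : Type u} [Category.{v} C] [Abelian C] [Linear k C]
variable (V : Type*) [AddCommGroup V] [Module k V] [Module.Finite k V]
  [Module E V] [IsScalarTower k E V]

/-- The action of `E` on `V ⊗ X` through `V`. -/
def copowerActLeft (X : C) : E →ₗ[k] (copower k V X ⟶ copower k V X) where
  toFun e := copowerMap (Algebra.lsmul k k V e) X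
  map_add' a b := by rw [map_add, copowerMap_add]
  map_smul' c a := copower_hom_ext fun x => by
    rw [RingHom.id_apply, Linear.comp_smul, ι_copowerMap, ι_copowerMap]
    simp

theorem ι_copowerActLeft (X : C) (e : E) (x : V) :
    copowerι k V X x ≫ copowerActLeft V X e = copowerι k V X (e • x) :=
  ι_copowerMap _ _ _

theorem ι_copowerActLeft_assoc (X : C) (e : E) (x : V) {Z : C} (h : copower k V X ⟶ Z) :
    copowerι k V X x ≫ copowerActLeft V X e ≫ h = copowerι k V X (e • x) ≫ h := by
  simpa only [Category.assoc] using (ι_copowerActLeft V X e x) =≫ h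

omit [Module E V] [IsScalarTower k E V]

/-- The action of `E` on `V ⊗ X` through `X`. -/
def copowerActRight (X : EMod k E C) : E →ₗ[k] (copower k V X.X ⟶ copower k V X.X) where
  toFun e := copowerObjMap k V (X.act e)
  map_add' a b := copower_hom_ext fun x => by
    simp only [ι_copowerObjMap, map_add, Preadditive.add_comp, Preadditive.comp_add]
  map_smul' c a := copower_hom_ext fun x => by
    simp only [ι_copowerObjMap, map_smul, Linear.smul_comp, Linear.comp_smul, RingHom.id_apply]

theorem ι_copowerActRight (X : EMod k E C) (e : E) (x : V) :
    copowerι k V X.X x ≫ copowerActRight V X e = X.act e ≫ copowerι k V X.X x :=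
  ι_copowerObjMap _ _

theorem ι_copowerActRight_assoc (X : EMod k E C) (e : E) (x : V) {Z : C}
    (h : copower k V X.X ⟶ Z) :
    copowerι k V X.X x ≫ copowerActRight V X e ≫ h = X.act e ≫ copowerι k V X.X x ≫ h := by
  simpa only [Category.assoc] using (ι_copowerActRight V X e x) =≫ h

variable [Module E V] [IsScalarTower k E V]

theorem copower_commutingActions (X : EMod k E C) :
    CommutingActions (copowerActLeft (E := E) V X.X) (copowerActRight V X) where
  left_mul a b := copower_hom_ext fun x => by
    rw [ι_copowerActLeft, ι_copowerActLeft_assoc, ι_copowerActLeft, ← mul_smul, mul_comm]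
  right_mul a b := copower_hom_ext fun x => by
    rw [ι_copowerActRight, ι_copowerActRight_assoc, ι_copowerActRight, mul_comm, EMod.act_mul,
      Category.assoc]
  comm a b := copower_hom_ext fun x => by
    rw [ι_copowerActLeft_assoc, ι_copowerActRight, ι_copowerActRight_assoc, ι_copowerActLeft]

variable {V} in
/-- The bar complex of `E ⊗ X` is exact. -/
theorem barExact_of_linearEquiv [Module.Finite k E] (φ : V ≃ₗ[E] E) (X : EMod k E C) :
    BarExact (copowerActLeft (E := E) V X.X) (copowerActRight V X) := by
  let φ' : V →ₗ[k] E := φ.toLinearMap.restrictScalars k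
  let u : V := φ.symm 1
  have hu : ∀ x, φ' x • u = x := fun x => by
    change φ x • φ.symm 1 = x
    rw [← map_smul, smul_eq_mul, mul_one, φ.symm_apply_apply]
  have hφ : ∀ (e : E) (x : V), φ' (e • x) = e * φ' x := fun e x => map_smul φ e x
  -- Contracting homotopy of the bar resolution, with u the generator of V: h₀ sends x to φ(x) ⊗ u,
  -- and h₁ sends e ⊗ x to φ(x) ⊗ e ⊗ u. In d₂(φ(x) ⊗ e ⊗ u) the first term is e ⊗ φ(x)u = e ⊗ x,
  -- and the other two are cancelled by h₀ applied to d₁(e ⊗ x).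
  let h₀ : copower k V X.X ⟶ copower k E (copower k V X.X) :=
    copowerDesc ((Linear.leftComp k _ (copowerι k V X.X u)).comp
      ((copowerι k E (copower k V X.X)).comp φ'))
  have hh₀ : ∀ x, copowerι k V X.X x ≫ h₀ =
      copowerι k V X.X u ≫ copowerι k E (copower k V X.X) (φ' x) := fun x => ι_copowerDesc _ x
  let h₁e (e : E) : copower k V X.X ⟶ copower k (E ⊗[k] E) (copower k V X.X) :=
    copowerDesc ((Linear.leftComp k _ (copowerι k V X.X u)).comp
      ((copowerι k (E ⊗[k] E) (copower k V X.X)).comp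
        (((TensorProduct.mk k E E).flip e).comp φ')))
  have hh₁e : ∀ e x, copowerι k V X.X x ≫ h₁e e =
      copowerι k V X.X u ≫ copowerι k (E ⊗[k] E) (copower k V X.X) (φ' x ⊗ₜ e) :=
    fun e x => ι_copowerDesc _ x
  let h₁ : copower k E (copower k V X.X) ⟶ copower k (E ⊗[k] E) (copower k V X.X) :=
    copowerDesc
      { toFun := h₁e
        map_add' := fun a b => copower_hom_ext fun x => by
          simp only [Preadditive.comp_add, hh₁e, TensorProduct.tmul_add, map_add]
        map_smul' := fun c a => copower_hom_ext fun x => by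
          simp only [Linear.comp_smul, hh₁e, TensorProduct.tmul_smul, map_smul,
            RingHom.id_apply] }
  have hh₁ : ∀ e, copowerι k E (copower k V X.X) e ≫ h₁ = h₁e e := fun e => ι_copowerDesc _ e
  have key : h₁ ≫ barD₂ (copowerActLeft (E := E) V X.X) (copowerActRight V X) +
      barD₁ (copowerActLeft (E := E) V X.X) (copowerActRight V X) ≫ h₀ = 𝟙 _ := by
    refine copower_hom_ext fun e => copower_hom_ext fun x => ?_
    rw [Preadditive.comp_add, ← Category.assoc, hh₁, ι_barD₁_assoc, Preadditive.comp_add,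
      ← Category.assoc, hh₁e, Category.assoc, ι_barD₂, Preadditive.sub_comp,
      Preadditive.comp_sub, ι_copowerActLeft_assoc, hh₀, ι_copowerActRight_assoc, hh₀,
      Preadditive.comp_add, Preadditive.comp_sub, ι_copowerActLeft_assoc,
      ι_copowerActRight_assoc, hu, hφ, mul_comm e, Category.comp_id]
    abel
  intro T x hx
  refine ⟨T, 𝟙 T, inferInstance, x ≫ h₁, ?_⟩
  have := x ≫= key
  rw [Preadditive.comp_add, ← Category.assoc x (barD₁ _ _), hx, zero_comp, add_zero,
    Category.comp_id] at this
  rw [Category.id_comp, Category.assoc, this]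

omit [Module E V] [IsScalarTower k E V]

variable [Module.Finite k E]

theorem extπ_isCoinvariants (M : FGModuleCat.{w} E) (X : EMod k E C) :
    IsCoinvariants (copowerActLeft (E := E) (k := k) M.obj X.X) (copowerActRight M.obj X)
      (extπ M X) := by
  refine IsCoinvariants.of_universal ?_ ?_ ?_
  · intro e
    refine copower_hom_ext fun m => ?_
    rw [ι_copowerActLeft_assoc, ι_copowerActRight_assoc, ext_condition]
  · intro W f hf
    refine ⟨extDesc M X f fun m e => ?_, extπ_desc M X f _⟩
    have := copowerι k M.obj X.X m ≫= hf e
    rwa [ι_copowerActLeft_assoc, ι_copowerActRight_assoc] at this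
  · intro W f g h
    exact ext_hom_ext M X fun m => by rw [h]

variable [MonoidalCategory C] [MonoidalPreadditive C] [MonoidalLinear k C]

omit [Module.Finite k E] in
theorem tensor_commutingActions (Y X : EMod k E C) :
    CommutingActions (actLeft Y X) (actRight Y X) where
  left_mul a b := by
    change Y.act (a * b) ▷ X.X = Y.act a ▷ X.X ≫ Y.act b ▷ X.X
    rw [EMod.act_mul, EMod.act_comm, comp_whiskerRight]
  right_mul a b := by
    change Y.X ◁ X.act (a * b) = Y.X ◁ X.act a ≫ Y.X ◁ X.act b
    rw [EMod.act_mul, EMod.act_comm, MonoidalCategory.whiskerLeft_comp]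
  comm a b := (whisker_exchange _ _).symm

theorem tensorπ_isCoinvariants (Y X : EMod k E C) :
    IsCoinvariants (actLeft Y X) (actRight Y X) (tensorπ Y X) :=
  IsCoinvariants.of_universal (tensor_condition Y X)
    (fun f hf => ⟨tensorDesc Y X f hf, tensorπ_desc Y X f hf⟩)
    (fun _ _ h => tensor_hom_ext Y X h)

end ModuleCopower

/-! ### Modules killed by the nilradical -/

section Separable

open scoped TensorProduct

/-- A finite commutative algebra with separable elements has a separability idempotent. -/
theorem exists_separability_idempotent (k S : Type*) [Field k] [CommRing S] [Algebra k S]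
    [Module.Finite k S] [Algebra.IsSeparable k S] :
    ∃ t : S ⊗[k] S, (∀ s : S, ((1 : S) ⊗ₜ[k] s) * t = (s ⊗ₜ[k] (1 : S)) * t) ∧
      Algebra.TensorProduct.lmul' k t = 1 := by
  -- Differentiating p(x) = 0 for the minimal polynomial p gives p′(x) dx = 0, and p′(x) is
  -- invertible by the Bézout relation expressing separability. Hence the differentials vanish and S
  -- is unramified, which for a finite algebra yields the idempotent.
  have hD : ∀ x : S, KaehlerDifferential.D k S x = 0 := by
    intro x
    obtain ⟨a, b, hab⟩ := Algebra.IsSeparable.isSeparable k x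
    have h1 : Polynomial.aeval x b * Polynomial.aeval x (minpoly k x).derivative = 1 := by
      have := congrArg (Polynomial.aeval x) hab
      simpa using this
    have h2 := (KaehlerDifferential.D k S).map_aeval (minpoly k x) x
    rw [minpoly.aeval, map_zero] at h2
    rw [← one_smul S (KaehlerDifferential.D k S x), ← h1, mul_smul, ← h2, smul_zero]
  have : Algebra.FormallyUnramified k S := by
    refine ⟨Submodule.subsingleton_iff S |>.1 (subsingleton_of_bot_eq_top ?_)⟩
    rw [← KaehlerDifferential.span_range_derivation k S, eq_comm, Submodule.span_eq_bot]
    rintro _ ⟨x, rfl⟩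
    exact hD x
  obtain ⟨t, h1, h2⟩ := Algebra.FormallyUnramified.iff_exists_tensorProduct.1 this
  exact ⟨t, fun s => by rw [← sub_eq_zero, ← sub_mul, h1], h2⟩

variable {k : Type*} [Field k] {E : Type w} [CommRing E] [Algebra k E]
variable {C : Type u} [Category.{v} C] [Abelian C] [Linear k C]

/-- The action of `E ⧸ I` on a module killed by `I`. -/
def EMod.quotAct (Q : EMod k E C) (I : Ideal E) (hQ : ∀ a ∈ I, Q.act a = 0) :
    (E ⧸ I) →ₗ[k] (Q.X ⟶ Q.X) :=
  (Ideal.Quotient.liftₐ I Q.ρ hQ).toLinearMap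

theorem EMod.quotAct_mk (Q : EMod k E C) (I : Ideal E) (hQ : ∀ a ∈ I, Q.act a = 0) (e : E) :
    Q.quotAct I hQ (Ideal.Quotient.mk I e) = Q.act e := rfl

theorem EMod.quotAct_mul (Q : EMod k E C) (I : Ideal E) (hQ : ∀ a ∈ I, Q.act a = 0)
    (a b : E ⧸ I) : Q.quotAct I hQ (a * b) = Q.quotAct I hQ b ≫ Q.quotAct I hQ a :=
  map_mul (Ideal.Quotient.liftₐ I Q.ρ hQ) a b

theorem EMod.quotAct_one (Q : EMod k E C) (I : Ideal E) (hQ : ∀ a ∈ I, Q.act a = 0) :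
    Q.quotAct I hQ 1 = 𝟙 _ :=
  map_one (Ideal.Quotient.liftₐ I Q.ρ hQ)

variable [Module.Finite k E]
variable [MonoidalCategory C] [MonoidalPreadditive C] [MonoidalLinear k C]

/-- Write t = Σ a ⊗ b for the separability idempotent. Then z ↦ Σ bz ⊗ a is a section of the
multiplication map Q ⊗ E/I → Q. After tensoring with X it makes Q ⊗ X a retract of Q ⊗ (V ⊗ X),
where the left action goes through V and not through Q. The bar complex of the latter is exact,
being the image of that of V ⊗ X under the exact functor Q ⊗ −. -/
theorem barExact_tensor {I : Ideal E} [Algebra.IsSeparable k (E ⧸ I)]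
    {V : Type*} [AddCommGroup V] [Module k V] [Module.Finite k V] [Module E V]
    [IsScalarTower k E V] (φ : V ≃ₗ[E] E ⧸ I) {Q X : EMod k E C}
    (hX : BarExact (copowerActLeft (E := E) (k := k) V X.X) (copowerActRight V X))
    (hexact : exactFunctor C C (tensorLeft Q.X)) (hQ : ∀ a ∈ I, Q.act a = 0) :
    BarExact (actLeft Q X) (actRight Q X) := by
  obtain ⟨t, ht, ht1⟩ := exists_separability_idempotent k (E ⧸ I)
  obtain ⟨_, _⟩ := (exactFunctor_iff _).1 hexact
  let q := Q.quotAct I hQ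
  let G := tensorLeft Q.X
  have : G.Linear k := ⟨fun f r => MonoidalLinear.whiskerLeft_smul _ _ _⟩
  let R : (Q.X ⟶ Q.X) →ₗ[k] (Q.X ⊗ X.X ⟶ Q.X ⊗ X.X) :=
    { toFun f := f ▷ X.X
      map_add' a b := by simp
      map_smul' c a := by simp }
  let p : Q.X ⊗ copower k V X.X ⟶ Q.X ⊗ X.X :=
    mapCopowerDesc (G := G) (R.comp (q.comp (φ.toLinearMap.restrictScalars k)))
  have hp : ∀ x, Q.X ◁ copowerι k V X.X x ≫ p = q (φ x) ▷ X.X :=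
    fun x => map_ι_mapCopowerDesc G _ x
  let ψ : (E ⧸ I) →ₗ[k] V := φ.symm.toLinearMap.restrictScalars k
  have hψ : ∀ a, φ (ψ a) = a := φ.apply_symm_apply
  have hψ' : ∀ (e : E) a, ψ (Ideal.Quotient.mk I e * a) = e • ψ a :=
    fun e a => map_smul φ.symm e a
  -- The section is defined for an arbitrary tensor, so that its properties, linear in the tensor,
  -- can be checked on pure tensors.
  let σ : (E ⧸ I) ⊗[k] (E ⧸ I) →ₗ[k] (Q.X ⊗ X.X ⟶ Q.X ⊗ copower k V X.X) :=
    TensorProduct.lift (LinearMap.mk₂ k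
      (fun a b => q b ▷ X.X ≫ Q.X ◁ copowerι k V X.X (ψ a))
      (fun a b c => by simp) (fun c a b => by simp) (fun a b c => by simp)
      (fun c a b => by simp))
  have hσ : ∀ a b, σ (a ⊗ₜ b) = q b ▷ X.X ≫ Q.X ◁ copowerι k V X.X (ψ a) :=
    fun a b => TensorProduct.lift.tmul _ _
  have hσp : ∀ t, σ t ≫ p = q (Algebra.TensorProduct.lmul' k t) ▷ X.X := by
    intro t
    induction t with
    | zero => simp
    | tmul a b =>
      rw [hσ, Category.assoc, hp, hψ, Algebra.TensorProduct.lmul'_apply_tmul,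
        EMod.quotAct_mul, comp_whiskerRight]
    | add a b ha hb => simp only [map_add, Preadditive.add_comp, ha, hb,
        MonoidalPreadditive.add_whiskerRight]
  have hσl : ∀ (e : E) t, Q.act e ▷ X.X ≫ σ t = σ ((1 ⊗ₜ Ideal.Quotient.mk I e) * t) := by
    intro e t
    induction t with
    | zero => simp
    | tmul a b =>
      rw [Algebra.TensorProduct.tmul_mul_tmul, one_mul, hσ, hσ, mul_comm, EMod.quotAct_mul,
        EMod.quotAct_mk, comp_whiskerRight, Category.assoc]
    | add a b ha hb => simp only [map_add, Preadditive.comp_add, ha, hb, mul_add]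
  have hσl' : ∀ (e : E) t, σ t ≫ Q.X ◁ copowerActLeft V X.X e =
      σ ((Ideal.Quotient.mk I e ⊗ₜ 1) * t) := by
    intro e t
    induction t with
    | zero => simp
    | tmul a b =>
      rw [Algebra.TensorProduct.tmul_mul_tmul, one_mul, hσ, hσ, hψ', Category.assoc,
        ← MonoidalCategory.whiskerLeft_comp, ι_copowerActLeft]
    | add a b ha hb => simp only [map_add, Preadditive.add_comp, ha, hb, mul_add]
  have hσr : ∀ (e : E) t, Q.X ◁ X.act e ≫ σ t = σ t ≫ Q.X ◁ copowerActRight V X e := by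
    intro e t
    induction t with
    | zero => simp
    | tmul a b =>
      rw [hσ, Category.assoc, ← MonoidalCategory.whiskerLeft_comp, ι_copowerActRight,
        MonoidalCategory.whiskerLeft_comp, whisker_exchange_assoc]
    | add a b ha hb => simp only [map_add, Preadditive.add_comp, Preadditive.comp_add, ha, hb]
  refine (hX.map (copower_commutingActions V X) G).of_retract (σ t) p ?_ ?_ ?_ ?_ ?_
  · rw [hσp, ht1, EMod.quotAct_one, id_whiskerRight]
  · intro e
    change Q.act e ▷ X.X ≫ σ t = σ t ≫ Q.X ◁ copowerActLeft V X.X e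
    -- The identity (1 ⊗ s)t = (s ⊗ 1)t says that the section exchanges the action on Q for the
    -- action on V.
    rw [hσl, hσl', ht]
  · intro e
    exact hσr e t
  · intro e
    refine map_copower_hom_ext (G := G) (k := k) fun x => ?_
    change Q.X ◁ copowerι k V X.X x ≫ Q.X ◁ copowerActLeft V X.X e ≫ p =
      Q.X ◁ copowerι k V X.X x ≫ p ≫ Q.act e ▷ X.X
    rw [← MonoidalCategory.whiskerLeft_comp_assoc, ι_copowerActLeft, hp, ← Category.assoc, hp,
      map_smul, ← comp_whiskerRight, ← Q.quotAct_mk I hQ, ← EMod.quotAct_mul]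
    rfl
  · intro e
    refine map_copower_hom_ext (G := G) (k := k) fun x => ?_
    change Q.X ◁ copowerι k V X.X x ≫ Q.X ◁ copowerActRight V X e ≫ p =
      Q.X ◁ copowerι k V X.X x ≫ p ≫ Q.X ◁ X.act e
    rw [← MonoidalCategory.whiskerLeft_comp_assoc, ι_copowerActRight, ← Category.assoc, hp,
      MonoidalCategory.whiskerLeft_comp_assoc, hp, whisker_exchange]

end Separable

/-! ### Vanishing of Tor₁(E/I, X) for flat X. -/

section Flat

open scoped ModuleCat

variable {k : Type*} [Field k] {E : Type w} [CommRing E] [Algebra k E] [Module.Finite k E]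
variable {C : Type u} [Category.{v} C] [Abelian C] [Linear k C]

/-- Dimension shifting: H₁ vanishes for the free module F, and flatness makes K ⊗_E X → F ⊗_E X
mono, so H₁ vanishes for M. -/
theorem IsFlat.barExact_of_presentation {X : EMod k E C} (hX : IsFlat X)
    {K F M : FGModuleCat.{w} E} (i : K ⟶ F) (p : F ⟶ M) (φ : F.obj ≃ₗ[E] E)
    (hi : Function.Injective i.hom.hom) (hp : Function.Surjective p.hom.hom)
    (hip : Function.Exact i.hom.hom p.hom.hom) :
    BarExact (copowerActLeft (E := E) (k := k) M.obj X.X) (copowerActRight M.obj X) := by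
  obtain ⟨_, _⟩ := (exactFunctor_iff _).1 hX
  have : Mono i := ConcreteCategory.mono_of_injective i hi
  have hS := copowerMap_shortExact (k := k) (f := toLin i) (g := toLin p) hi hp hip X.X
  have hmono : Mono (extMap i X) := (extFunctor X).map_mono i
  have hnat : ∀ {M N : FGModuleCat.{w} E} (f : M ⟶ N) (e : E),
      copowerActLeft M.obj X.X e ≫ copowerMap (toLin (k := k) f) X.X =
        copowerMap (toLin f) X.X ≫ copowerActLeft N.obj X.X e := fun {M N} f e =>
    copower_hom_ext fun x => by
      rw [ι_copowerActLeft_assoc, ι_copowerMap, ι_copowerMap_assoc, ι_copowerActLeft]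
      exact congrArg _ (map_smul f.hom.hom e x)
  exact BarExact.of_shortExact hS (hnat i)
    (fun e => (copowerObjMap_map (X.act e) (toLin i)).symm) (hnat p)
    (fun e => (copowerObjMap_map (X.act e) (toLin p)).symm)
    (barExact_of_linearEquiv φ X)
    (extπ_isCoinvariants _ X) (extπ_isCoinvariants _ X) (extMap i X)
    (extπ_desc _ _ _ _)

/-- If `X` is flat, then the bar complex of `E ⧸ I ⊗ X` is exact. -/
theorem IsFlat.exists_barExact {X : EMod k E C} (hX : IsFlat X) (I : Ideal E) :
    ∃ (M : FGModuleCat.{w} E) (_ : M.obj ≃ₗ[E] E ⧸ I),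
      BarExact (copowerActLeft (E := E) (k := k) M.obj X.X) (copowerActRight M.obj X) := by
  have : IsNoetherianRing E := IsNoetherianRing.of_finite k E
  let i : FGModuleCat.of E I ⟶ FGModuleCat.of E E := FGModuleCat.ofHom (Submodule.subtype I)
  let p : FGModuleCat.of E E ⟶ FGModuleCat.of E (E ⧸ I) := FGModuleCat.ofHom (Submodule.mkQ I)
  have h1 : Function.Injective i.hom.hom := Subtype.val_injective
  have h2 : Function.Surjective p.hom.hom := Submodule.mkQ_surjective I
  have h3 : Function.Exact i.hom.hom p.hom.hom := LinearMap.exact_subtype_mkQ I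
  let φ : (FGModuleCat.of E E).obj ≃ₗ[E] E := LinearEquiv.refl E E
  exact ⟨_, LinearEquiv.refl E (E ⧸ I), hX.barExact_of_presentation i p φ h1 h2 h3⟩

end Flat

/-! ### Filtrations by powers of nilpotent elements -/

namespace EMod

variable {k : Type*} [Field k] {E : Type w} [CommRing E] [Algebra k E]
variable {C : Type u} [Category.{v} C] [Abelian C] [Linear k C]

/-- The action of an element of `E`, as a morphism of `E`-modules. -/
def actHom (M : EMod k E C) (e : E) : M ⟶ M := mkHom (M.act e) fun a => M.act_comm a e

theorem actHom_naturality {M N : EMod k E C} (f : M ⟶ N) (e : E) :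
    M.actHom e ≫ f = f ≫ N.actHom e := hom_ext (hom_comm f e)

theorem actHom_mul (M : EMod k E C) (a b : E) : M.actHom (a * b) = M.actHom b ≫ M.actHom a :=
  hom_ext (M.act_mul a b)

theorem actHom_add (M : EMod k E C) (a b : E) : M.actHom (a + b) = M.actHom a + M.actHom b :=
  hom_ext (map_add M.act a b)

theorem actHom_zero (M : EMod k E C) : M.actHom 0 = 0 := hom_ext (map_zero M.act)

/-- The annihilator of the cokernel of a morphism. -/
def cokernelAnnihilator {A B : EMod k E C} (i : A ⟶ B) : Ideal E where
  carrier := {e | B.actHom e ≫ cokernel.π i = 0}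
  zero_mem' := by simp [actHom_zero]
  add_mem' {a b} ha hb := by
    simp only [Set.mem_ofPred_eq] at *
    rw [actHom_add, Preadditive.add_comp, ha, hb, add_zero]
  smul_mem' c a ha := by
    simp only [Set.mem_ofPred_eq, smul_eq_mul] at *
    rw [mul_comm, actHom_mul, Category.assoc, ha, comp_zero]

theorem mem_cokernelAnnihilator {A B : EMod k E C} (i : A ⟶ B) (e : E) :
    e ∈ cokernelAnnihilator i ↔ B.actHom e ≫ cokernel.π i = 0 := Iff.rfl

/-- A monomorphism is the kernel of its cokernel. Together with `mem_cokernelAnnihilator_of_eq`,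
this lets the inclusion eB ⊆ A be handled as a factorisation of e through A. -/
theorem exists_of_mem_cokernelAnnihilator {A B : EMod k E C} {i : A ⟶ B} [Mono i] {e : E}
    (h : e ∈ cokernelAnnihilator i) : ∃ g : B ⟶ A, g ≫ i = B.actHom e :=
  ⟨_, (Abelian.monoLift_comp i _ h)⟩

theorem mem_cokernelAnnihilator_of_eq {A B : EMod k E C} {i : A ⟶ B} {e : E} (g : B ⟶ A)
    (h : g ≫ i = B.actHom e) : e ∈ cokernelAnnihilator i := by
  rw [mem_cokernelAnnihilator, ← h, Category.assoc, cokernel.condition, comp_zero]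

/-- If the square of `e` kills the cokernel of a monomorphism `A ⟶ B`, then this monomorphism
factors through a submodule `A + e B` of `B`. -/
theorem exists_factorization {A B : EMod k E C} (i : A ⟶ B) [Mono i] {e : E}
    (he : e * e ∈ cokernelAnnihilator i) :
    ∃ (D : EMod k E C) (j : A ⟶ D) (l : D ⟶ B) (_ : Mono j) (_ : Mono l), j ≫ l = i ∧
      e ∈ cokernelAnnihilator j ∧ e ∈ cokernelAnnihilator l ∧
      cokernelAnnihilator i ≤ cokernelAnnihilator j ∧
      cokernelAnnihilator i ≤ cokernelAnnihilator l := by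
  let s : A ⊞ B ⟶ B := biprod.desc i (B.actHom e)
  let D := Abelian.image s
  let l : D ⟶ B := Abelian.image.ι s
  let π : A ⊞ B ⟶ D := Abelian.factorThruImage s
  have hπ : π ≫ l = s := Abelian.image.fac s
  let j : A ⟶ D := biprod.inl ≫ π
  have hj : j ≫ l = i := by rw [Category.assoc, hπ, biprod.inl_desc]
  have hmj : Mono j := mono_of_mono_fac hj
  have hl : (biprod.inr ≫ π) ≫ l = B.actHom e := by rw [Category.assoc, hπ, biprod.inr_desc]
  refine ⟨D, j, l, hmj, inferInstance, hj, ?_, mem_cokernelAnnihilator_of_eq _ hl, ?_, ?_⟩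
  -- The element e maps A + eB into A, because e²B ⊆ A. This is tested on the cover A ⊕ B of A + eB,
  -- where `g` is multiplication by e² seen as a map from B to A.
  · obtain ⟨g, hg⟩ := exists_of_mem_cokernelAnnihilator he
    rw [mem_cokernelAnnihilator, ← cancel_epi π, comp_zero, ← Category.assoc,
      ← actHom_naturality, Category.assoc]
    have h1 : (A ⊞ B).actHom e ≫ π = biprod.desc (A.actHom e) g ≫ j := by
      rw [← cancel_mono l, Category.assoc, Category.assoc, hπ, hj, actHom_naturality]
      refine biprod.hom_ext' _ _ ?_ ?_
      · rw [biprod.inl_desc_assoc, biprod.inl_desc_assoc, actHom_naturality]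
      · rw [biprod.inr_desc_assoc, biprod.inr_desc_assoc, hg, actHom_mul]
    rw [← Category.assoc, h1, Category.assoc, cokernel.condition, comp_zero]
  · intro x hx
    obtain ⟨g, hg⟩ := exists_of_mem_cokernelAnnihilator hx
    refine mem_cokernelAnnihilator_of_eq (l ≫ g) ?_
    rw [← cancel_mono l, Category.assoc, Category.assoc, hj, hg, actHom_naturality]
  · intro x hx
    obtain ⟨g, hg⟩ := exists_of_mem_cokernelAnnihilator hx
    exact mem_cokernelAnnihilator_of_eq (g ≫ j) (by rw [Category.assoc, hj, hg])

/-- A property of monomorphisms which is stable under composition holds for all monomorphisms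
as soon as it holds for those whose cokernel is killed by the nilradical. -/
theorem mono_induction [IsNoetherianRing E] (P : ∀ {A B : EMod k E C}, (A ⟶ B) → Prop)
    (hcomp : ∀ {A B D : EMod k E C} (f : A ⟶ B) (g : B ⟶ D), P f → P g → P (f ≫ g))
    (hnil : ∀ {A B : EMod k E C} (f : A ⟶ B) [Mono f],
      nilradical E ≤ cokernelAnnihilator f → P f)
    {A B : EMod k E C} (f : A ⟶ B) [Mono f] : P f := by
  -- Noetherian induction on the annihilator of the cokernel: the claim is assumed for strictly
  -- larger annihilators.
  suffices H : ∀ (I : Ideal E) {A B : EMod k E C} (f : A ⟶ B) [Mono f],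
      cokernelAnnihilator f = I → P f from H _ f rfl
  intro I
  induction I using WellFoundedGT.induction with
  | ind I ih =>
    intro A B f _ hI
    by_cases h : nilradical E ≤ cokernelAnnihilator f
    · exact hnil f h
    -- Take a nilpotent a outside the annihilator, and m such that aᵐ is outside but aᵐ⁺¹ inside.
    -- Since m ≥ 1, 2m ≥ m + 1, so e = aᵐ has its square inside and `exists_factorization` applies.
    -- Both new annihilators contain the old one and also e, so they are strictly larger.
    obtain ⟨a, ⟨n, hn⟩, ha⟩ := Set.not_subset.1 h
    classical
    have hex : ∃ n, a ^ n ∈ cokernelAnnihilator f := ⟨n, by rw [hn]; exact zero_mem _⟩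
    obtain ⟨m, hm⟩ : ∃ m, Nat.find hex = m + 1 := by
      refine Nat.exists_eq_succ_of_ne_zero fun h0 => ha ?_
      have := Nat.find_spec hex
      rw [h0, pow_zero] at this
      rw [(Ideal.eq_top_iff_one _).2 this]
      exact Submodule.mem_top
    have h1 : a ^ m ∉ cokernelAnnihilator f := Nat.find_min hex (by omega)
    have h2 : a ^ (m + 1) ∈ cokernelAnnihilator f := hm ▸ Nat.find_spec hex
    have hm0 : m ≠ 0 := by
      rintro rfl
      rw [zero_add, pow_one] at h2
      exact ha h2
    have h3 : a ^ m * a ^ m ∈ cokernelAnnihilator f := by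
      rw [← pow_add, show m + m = (m - 1) + (m + 1) by omega, pow_add]
      exact Ideal.mul_mem_left _ _ h2
    obtain ⟨D, j, l, _, _, hjl, hj, hl, hj', hl'⟩ := exists_factorization f h3
    rw [← hjl]
    subst hI
    exact hcomp _ _
      (ih _ (lt_of_le_of_ne hj' fun h => h1 (h ▸ hj)) j rfl)
      (ih _ (lt_of_le_of_ne hl' fun h => h1 (h ▸ hl)) l rfl)

end EMod

/-! ### Exactness of the tensor product with a flat module -/

section TensorExact

open scoped ModuleCat

variable {k : Type*} [Field k] {E : Type w} [CommRing E] [Algebra k E] [Module.Finite k E]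
variable {C : Type u} [Category.{v} C] [Abelian C] [Linear k C]
variable [MonoidalCategory C] [MonoidalPreadditive C] [MonoidalLinear k C]

theorem tensorMap_comp {Y Y' Y'' : EMod k E C} (f : Y ⟶ Y') (g : Y' ⟶ Y'') (X : EMod k E C) :
    tensorMap (f ≫ g) X = tensorMap f X ≫ tensorMap g X :=
  congrArg EMod.Hom.hom ((tensorFunctor X).map_comp f g)

instance (X : EMod k E C) : (tensorFunctor X ⋙ EMod.forget k E C).Additive where
  map_add {Y Y' f g} := tensor_hom_ext Y X (by
    change tensorπ Y X ≫ tensorMap (f + g) X =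
      tensorπ Y X ≫ (tensorMap f X + tensorMap g X)
    rw [Preadditive.comp_add, tensorπ_map, tensorπ_map, tensorπ_map, EMod.add_hom,
      MonoidalPreadditive.add_whiskerRight, Preadditive.add_comp])

omit [Module.Finite k E] [MonoidalLinear k C] in
/-- Tensoring the underlying short exact sequence with an object. -/
theorem whiskerRight_shortExact (hright : ∀ Z : C, exactFunctor C C (tensorRight Z))
    {S : ShortComplex (EMod k E C)} (hS : S.ShortExact) (Z : C) :
    (ShortComplex.mk (S.f.hom ▷ Z) (S.g.hom ▷ Z) (by
      rw [← comp_whiskerRight, EMod.hom_comp_eq_zero S.zero,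
        MonoidalPreadditive.zero_whiskerRight])).ShortExact := by
  obtain ⟨_, _⟩ := (exactFunctor_iff _).1 (hright Z)
  exact (hS.map_of_exact (EMod.forget k E C)).map_of_exact (tensorRight Z)

instance tensorπ_epi (Y X : EMod k E C) : Epi (tensorπ Y X) := (tensorπ_isCoinvariants Y X).epi

/-- The cokernel is a module over the separable algebra E/nil(E), so `barExact_tensor` makes its H₁
vanish, and the long exact sequence gives injectivity. -/
theorem tensorMap_mono_of_nilradical [Algebra.IsSeparable k (E ⧸ nilradical E)]
    (hleft : ∀ Z : C, exactFunctor C C (tensorLeft Z))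
    (hright : ∀ Z : C, exactFunctor C C (tensorRight Z)) {X : EMod k E C} (hX : IsFlat X)
    {A B : EMod k E C} (i : A ⟶ B) [Mono i] (hi : nilradical E ≤ EMod.cokernelAnnihilator i) :
    Mono (tensorMap i X) := by
  have hS : (ShortComplex.mk i (cokernel.π i) (cokernel.condition i)).ShortExact :=
    { exact := ShortComplex.exact_cokernel i }
  have hQ : ∀ a ∈ nilradical E, (cokernel i).act a = 0 := fun a ha => by
    have h := EMod.actHom_naturality (cokernel.π i) a
    rw [(EMod.mem_cokernelAnnihilator i a).1 (hi ha)] at h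
    have h' : (cokernel i).actHom a = 0 := by
      rw [← cancel_epi (cokernel.π i), ← h, comp_zero]
    exact congrArg EMod.Hom.hom h'
  obtain ⟨M, φ, hM⟩ := hX.exists_barExact (nilradical E)
  have hbar := barExact_tensor φ hM (hleft _) hQ
  have hnat : ∀ {Y Y' : EMod k E C} (f : Y ⟶ Y') (e : E),
      actLeft Y X e ≫ f.hom ▷ X.X = f.hom ▷ X.X ≫ actLeft Y' X e := fun {Y Y'} f e => by
    change Y.act e ▷ X.X ≫ f.hom ▷ X.X = f.hom ▷ X.X ≫ Y'.act e ▷ X.X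
    rw [← comp_whiskerRight, EMod.hom_comm, comp_whiskerRight]
  exact mono_of_barExact (whiskerRight_shortExact hright hS X.X)
    (hnat i) (fun e => whisker_exchange _ _) (hnat _) (fun e => whisker_exchange _ _)
    (tensor_commutingActions B X) hbar (tensorπ_isCoinvariants A X) (tensorπ_isCoinvariants B X)
    (tensorMap i X) (tensorπ_map i X)

theorem tensorFunctor_exact [Algebra.IsSeparable k (E ⧸ nilradical E)]
    (hleft : ∀ Z : C, exactFunctor C C (tensorLeft Z))
    (hright : ∀ Z : C, exactFunctor C C (tensorRight Z)) {X : EMod k E C} (hX : IsFlat X) :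
    exactFunctor (EMod k E C) (EMod k E C) (tensorFunctor X) := by
  have : IsNoetherianRing E := IsNoetherianRing.of_finite k E
  rw [EMod.exactFunctor_iff_comp_forget, exactFunctor_iff]
  -- For an additive functor between abelian categories, exactness amounts to preserving short exact
  -- sequences.
  refine ((tensorFunctor X ⋙ EMod.forget k E C).exact_tfae.out 0 3).1 fun S hS => ?_
  have := hS.mono_f
  have hw := whiskerRight_shortExact hright hS X.X
  have hmono : Mono (tensorMap S.f X) :=
    EMod.mono_induction (fun f => Mono (tensorMap f X))
      (fun f g hf hg => by
        rw [tensorMap_comp]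
        exact mono_comp' hf hg)
      (fun f _ hf => tensorMap_mono_of_nilradical hleft hright hX f hf) S.f
  have hepi : Epi (tensorMap S.g X) := by
    have := hw.epi_g
    have h : Epi (tensorπ S.X₂ X ≫ tensorMap S.g X) := by
      rw [tensorπ_map]
      exact epi_comp' hw.epi_g inferInstance
    exact epi_of_epi (tensorπ S.X₂ X) (tensorMap S.g X)
  have h0 : tensorMap S.f X ≫ tensorMap S.g X = 0 :=
    (S.map (tensorFunctor X ⋙ EMod.forget k E C)).zero
  -- Right exactness: a map that kills Y₁ ⊗_E X descends to Y₃ ⊗ X by exactness of − ⊗ X. The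
  -- descended map equalises the two actions because it does so after the epimorphism from Y₂ ⊗ X,
  -- hence it factors through Y₃ ⊗_E X.
  have hd : ∀ {W : C} (f : tensorObj S.X₂ X ⟶ W), tensorMap S.f X ≫ f = 0 →
      ∃ g : tensorObj S.X₃ X ⟶ W, tensorMap S.g X ≫ g = f := by
    intro W f hf
    have h1 : S.f.hom ▷ X.X ≫ tensorπ S.X₂ X ≫ f = 0 := by
      rw [← Category.assoc, ← tensorπ_map, Category.assoc, hf, comp_zero]
    obtain ⟨g, hg⟩ : ∃ g : S.X₃.X ⊗ X.X ⟶ W, S.g.hom ▷ X.X ≫ g = tensorπ S.X₂ X ≫ f :=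
      have := hw.epi_g
      ⟨hw.exact.desc _ h1, hw.exact.g_desc _ h1⟩
    have hg' : ∀ e, S.X₃.act e ▷ X.X ≫ g = S.X₃.X ◁ X.act e ≫ g := fun e => by
      have := hw.epi_g
      rw [← cancel_epi (S.g.hom ▷ X.X), ← comp_whiskerRight_assoc, ← EMod.hom_comm,
        comp_whiskerRight_assoc, hg, ← whisker_exchange_assoc, hg, ← Category.assoc,
        tensor_condition, Category.assoc]
    refine ⟨tensorDesc _ _ g hg', tensor_hom_ext _ _ ?_⟩
    rw [← Category.assoc, tensorπ_map, Category.assoc, tensorπ_desc, hg]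
  choose d hd using @hd
  have hex : (ShortComplex.mk (tensorMap S.f X) (tensorMap S.g X) h0).Exact :=
    ShortComplex.exact_of_g_is_cokernel _ (CokernelCofork.IsColimit.ofπ _ h0
      (fun f hf => d f hf) (fun f hf => hd f hf)
      (fun f hf m hm => (cancel_epi (tensorMap S.g X)).1 (hm.trans (hd f hf).symm)))
  exact { exact := hex, mono_f := hmono, epi_g := hepi }

end TensorExact

/-! ### Extension of scalars as a tensor product of modules -/

section FreeModules

open scoped ModuleCat

variable {k : Type*} [Field k] {E : Type w} [CommRing E] [Algebra k E] [Module.Finite k E]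
variable {C : Type u} [Category.{v} C] [Abelian C] [Linear k C]

omit [Module.Finite k E] in
@[simp]
theorem toLin_apply {M N : FGModuleCat.{w} E} (f : M ⟶ N) (x : M.obj) :
    toLin (k := k) f x = f.hom.hom x := rfl

/-- The functor `M ↦ M ⊗ X` from finite `E`-modules to `E`-modules in `C`, for an object `X`. -/
def copowerModFunctor (k : Type*) [Field k] (E : Type w) [CommRing E] [Algebra k E]
    [Module.Finite k E] [Linear k C] (X : C) : FGModuleCat.{w} E ⥤ EMod k E C where
  obj M := EMod.ofAct (copower k M.obj X) (copowerActLeft M.obj X)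
    (copower_hom_ext fun x => by rw [ι_copowerActLeft, one_smul, Category.comp_id])
    (fun a b => copower_hom_ext fun x => by
      rw [ι_copowerActLeft, ι_copowerActLeft_assoc, ι_copowerActLeft, mul_smul])
  map {M N} f := EMod.mkHom (copowerMap (toLin f) X) fun e => by
    have : copowerActLeft M.obj X e ≫ copowerMap (toLin (k := k) f) X =
        copowerMap (toLin f) X ≫ copowerActLeft N.obj X e :=
      copower_hom_ext fun x => by
        rw [ι_copowerActLeft_assoc, ι_copowerMap, ι_copowerMap_assoc, ι_copowerActLeft]
        exact congrArg _ (map_smul f.hom.hom e x)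
    exact this
  map_id M := EMod.hom_ext (copowerMap_id X)
  map_comp f g := EMod.hom_ext (copowerMap_comp (toLin f) (toLin g) X).symm

/-- Exactness is tested after forgetting the action of E, and then only the underlying short exact
sequences of vector spaces matter; these split. -/
theorem copowerModFunctor_exact (X : C) :
    exactFunctor (FGModuleCat.{w} E) (EMod k E C) (copowerModFunctor k E X) := by
  have : IsNoetherianRing E := IsNoetherianRing.of_finite k E
  have : (copowerModFunctor k E X ⋙ EMod.forget k E C).Additive :=
    ⟨fun {M N f g} => copowerMap_add (toLin f) (toLin g) X⟩
  rw [EMod.exactFunctor_iff_comp_forget, exactFunctor_iff]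
  refine ((copowerModFunctor k E X ⋙ EMod.forget k E C).exact_tfae.out 0 3).1 fun S hS => ?_
  have hS' := hS.map_of_exact (forget₂ (FGModuleCat.{w} E) (ModuleCat.{w} E))
  have hi : Function.Injective S.f.hom.hom := (ModuleCat.mono_iff_injective _).1 hS'.mono_f
  have hs : Function.Surjective S.g.hom.hom := (ModuleCat.epi_iff_surjective _).1 hS'.epi_g
  have he : Function.Exact S.f.hom.hom S.g.hom.hom :=
    (CategoryTheory.ShortComplex.ShortExact.moduleCat_exact_iff_function_exact _).1 hS'.exact
  exact copowerMap_shortExact (k := k) (f := toLin S.f) (g := toLin S.g) hi hs he X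

variable [MonoidalCategory C] [MonoidalPreadditive C] [MonoidalLinear k C]

variable (M : FGModuleCat.{w} E) (X : EMod k E C)

/-- The projection `(M ⊗ 𝟙) ⊗ X ⟶ (M ⊗ 𝟙) ⊗_E X`. -/
def copowerTensorπ : copower k M.obj (𝟙_ C) ⊗ X.X ⟶
    tensorObj ((copowerModFunctor k E (𝟙_ C)).obj M) X :=
  tensorπ ((copowerModFunctor k E (𝟙_ C)).obj M) X

theorem copowerTensor_condition (m : M.obj) (e : E) :
    copowerι k M.obj (𝟙_ C) (e • m) ▷ X.X ≫ copowerTensorπ M X =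
      𝟙_ C ◁ X.act e ≫ copowerι k M.obj (𝟙_ C) m ▷ X.X ≫ copowerTensorπ M X := by
  have h : copowerActLeft M.obj (𝟙_ C) e ▷ X.X ≫ copowerTensorπ M X =
      copower k M.obj (𝟙_ C) ◁ X.act e ≫ copowerTensorπ M X :=
    tensor_condition ((copowerModFunctor k E (𝟙_ C)).obj M) X e
  rw [← ι_copowerActLeft, comp_whiskerRight, Category.assoc, h, whisker_exchange_assoc]

instance tensorRight_linear (Z : C) : (tensorRight Z).Linear k :=
  ⟨fun _ _ => MonoidalLinear.smul_whiskerRight _ _ _⟩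

omit [MonoidalLinear k C] in
theorem whiskerRight_copower_hom_ext {V : Type*} [AddCommGroup V] [Module k V]
    [Module.Finite k V] {X Y Z : C} {f g : copower k V X ⊗ Z ⟶ Y}
    (h : ∀ x : V, copowerι k V X x ▷ Z ≫ f = copowerι k V X x ▷ Z ≫ g) : f = g :=
  map_copower_hom_ext (k := k) (G := tensorRight Z) h

/-- The linear map `M → Hom(X, (M ⊗ 𝟙) ⊗_E X)`. -/
def copowerTensorι :
    M.obj →ₗ[k] (X.X ⟶ tensorObj ((copowerModFunctor k E (𝟙_ C)).obj M) X) where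
  toFun m := (λ_ X.X).inv ≫ copowerι k M.obj (𝟙_ C) m ▷ X.X ≫ copowerTensorπ M X
  map_add' a b := by simp [Preadditive.add_comp, Preadditive.comp_add]
  map_smul' c a := by simp

theorem copowerTensorι_apply (m : M.obj) : copowerTensorι (k := k) M X m =
    (λ_ X.X).inv ≫ copowerι k M.obj (𝟙_ C) m ▷ X.X ≫ copowerTensorπ M X := rfl

/-- The canonical morphism from `M ⊗_E X` to `(M ⊗ 𝟙) ⊗_E X`. -/
def extToTensor : extObj M X ⟶ tensorObj ((copowerModFunctor k E (𝟙_ C)).obj M) X :=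
  extDesc M X (copowerDesc (copowerTensorι M X)) fun m e => by
    rw [ι_copowerDesc, ι_copowerDesc, copowerTensorι_apply, copowerTensor_condition,
      copowerTensorι_apply, leftUnitor_inv_naturality_assoc]

theorem ι_extπ_extToTensor (m : M.obj) :
    copowerι k M.obj X.X m ≫ extπ M X ≫ extToTensor M X =
      (λ_ X.X).inv ≫ copowerι k M.obj (𝟙_ C) m ▷ X.X ≫ copowerTensorπ M X := by
  rw [extToTensor, extπ_desc, ι_copowerDesc, copowerTensorι_apply]

theorem ι_extπ_extToTensor_assoc (m : M.obj) {Z : C}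
    (h : tensorObj ((copowerModFunctor k E (𝟙_ C)).obj M) X ⟶ Z) :
    copowerι k M.obj X.X m ≫ extπ M X ≫ extToTensor M X ≫ h =
      (λ_ X.X).inv ≫ copowerι k M.obj (𝟙_ C) m ▷ X.X ≫ copowerTensorπ M X ≫ h := by
  simpa only [Category.assoc] using (ι_extπ_extToTensor M X m) =≫ h

/-- The canonical morphism from `(M ⊗ 𝟙) ⊗ X` to `M ⊗_E X`. -/
def copowerTensorToExt : copower k M.obj (𝟙_ C) ⊗ X.X ⟶ extObj M X :=
  mapCopowerDesc (G := tensorRight X.X) ((Linear.leftComp k _ (λ_ X.X).hom).comp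
      ((Linear.rightComp k _ (extπ M X)).comp (copowerι k M.obj X.X)))

theorem ι_copowerTensorToExt (m : M.obj) :
    copowerι k M.obj (𝟙_ C) m ▷ X.X ≫ copowerTensorToExt M X =
      (λ_ X.X).hom ≫ copowerι k M.obj X.X m ≫ extπ M X :=
  map_ι_mapCopowerDesc (tensorRight X.X) _ m

theorem ι_copowerTensorToExt_assoc (m : M.obj) {Z : C} (h : extObj M X ⟶ Z) :
    copowerι k M.obj (𝟙_ C) m ▷ X.X ≫ copowerTensorToExt M X ≫ h =
      (λ_ X.X).hom ≫ copowerι k M.obj X.X m ≫ extπ M X ≫ h := by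
  simpa only [Category.assoc] using (ι_copowerTensorToExt M X m) =≫ h

/-- The canonical morphism from `(M ⊗ 𝟙) ⊗_E X` to `M ⊗_E X`. -/
def tensorToExt : tensorObj ((copowerModFunctor k E (𝟙_ C)).obj M) X ⟶ extObj M X :=
  tensorDesc _ X (copowerTensorToExt M X) fun e => by
    have : copowerActLeft M.obj (𝟙_ C) e ▷ X.X ≫ copowerTensorToExt M X =
        copower k M.obj (𝟙_ C) ◁ X.act e ≫ copowerTensorToExt M X :=
      whiskerRight_copower_hom_ext (k := k) fun m => by
        rw [← comp_whiskerRight_assoc, ι_copowerActLeft, ι_copowerTensorToExt,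
          ← whisker_exchange_assoc, ι_copowerTensorToExt, ext_condition,
          ← leftUnitor_naturality_assoc]
    exact this

theorem copowerTensorπ_tensorToExt :
    copowerTensorπ M X ≫ tensorToExt M X = copowerTensorToExt M X := tensorπ_desc _ _ _ _

/-- `M ⊗_E X` is the tensor product over `E` of `M ⊗ 𝟙` and `X`. -/
def extIsoTensor : extObj M X ≅ tensorObj ((copowerModFunctor k E (𝟙_ C)).obj M) X where
  hom := extToTensor M X
  inv := tensorToExt M X
  hom_inv_id := ext_hom_ext M X fun m => by
    rw [ι_extπ_extToTensor_assoc, copowerTensorπ_tensorToExt, ι_copowerTensorToExt,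
      Iso.inv_hom_id_assoc, Category.comp_id]
  inv_hom_id := by
    refine tensor_hom_ext _ X ?_
    have : copowerTensorπ M X ≫ tensorToExt M X ≫ extToTensor M X =
        copowerTensorπ M X ≫ 𝟙 _ := by
      refine whiskerRight_copower_hom_ext (k := k) fun m => ?_
      rw [← Category.assoc (copowerTensorπ M X), copowerTensorπ_tensorToExt,
        ι_copowerTensorToExt_assoc, ι_extπ_extToTensor, Iso.hom_inv_id_assoc, Category.comp_id]
    exact this

theorem copowerTensorπ_map {M N : FGModuleCat.{w} E} (f : M ⟶ N) :
    copowerTensorπ M X ≫ tensorMap ((copowerModFunctor k E (𝟙_ C)).map f) X =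
      copowerMap (toLin f) (𝟙_ C) ▷ X.X ≫ copowerTensorπ N X := tensorπ_map _ _

/-- `M ⊗_E X` is naturally the tensor product over `E` of `M ⊗ 𝟙` and `X`. -/
def extFunctorIso : extFunctor X ≅
    copowerModFunctor k E (𝟙_ C) ⋙ tensorFunctor X ⋙ EMod.forget k E C :=
  NatIso.ofComponents (fun M => extIsoTensor M X) fun {M N} f => ext_hom_ext M X fun m => by
    change copowerι k M.obj X.X m ≫ extπ M X ≫ extMap f X ≫ extToTensor N X =
      copowerι k M.obj X.X m ≫ extπ M X ≫ extToTensor M X ≫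
        tensorMap ((copowerModFunctor k E (𝟙_ C)).map f) X
    rw [ι_extπ_extToTensor_assoc, copowerTensorπ_map, ← comp_whiskerRight_assoc, ι_copowerMap,
      toLin_apply, ← ι_extπ_extToTensor, ← Category.assoc (extπ M X), ← Category.assoc, ext_map,
      Category.assoc]

/-- If tensoring with `X` over `E` is exact, then `X` is flat. -/
theorem isFlat_of_tensorFunctor_exact
    (h : exactFunctor (EMod k E C) (EMod k E C) (tensorFunctor X)) : IsFlat X := by
  refine ((exactFunctor _ _).prop_iff_of_iso (extFunctorIso X)).2 ?_
  obtain ⟨_, _⟩ := (exactFunctor_iff _).1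
    (copowerModFunctor_exact (E := E) (k := k) (𝟙_ C))
  obtain ⟨_, _⟩ := (exactFunctor_iff _).1 ((EMod.exactFunctor_iff_comp_forget _).1 h)
  exact ⟨comp_preservesFiniteLimits _ _, comp_preservesFiniteColimits _ _⟩

end FreeModules

/-! ### The left dual functor -/

section LeftDual

open ExactPairing

variable {C : Type u} [Category.{v} C] [MonoidalCategory C]

section

variable [LeftRigidCategory C]

/-- Morphisms to the left dual of `A` are pairings with `A`. -/
def dualPairing (W A : C) : (W ⟶ ᘁA) ≃ (A ⊗ W ⟶ 𝟙_ C) :=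
  ((tensorLeftHomEquiv W (ᘁA) A (𝟙_ C)).trans (Iso.homToEquiv (ρ_ (ᘁA)))).symm

theorem dualPairing_apply {W A : C} (f : W ⟶ ᘁA) :
    dualPairing W A f = A ◁ f ≫ evaluation (ᘁA) A := by
  apply (dualPairing W A).symm.injective
  rw [Equiv.symm_apply_apply]
  change f = tensorLeftHomEquiv W (ᘁA) A (𝟙_ C) (A ◁ f ≫ evaluation (ᘁA) A) ≫ (ρ_ (ᘁA)).hom
  rw [tensorLeftHomEquiv_whiskerLeft_comp_evaluation, Category.assoc, Iso.inv_hom_id,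
    Category.comp_id]

theorem dualPairing_comp {V W A : C} (h : V ⟶ W) (f : W ⟶ ᘁA) :
    dualPairing V A (h ≫ f) = A ◁ h ≫ dualPairing W A f := by
  rw [dualPairing_apply, dualPairing_apply, MonoidalCategory.whiskerLeft_comp, Category.assoc]

theorem dualPairing_comp_mate {W A B : C} (f : W ⟶ ᘁB) (g : A ⟶ B) :
    dualPairing W A (f ≫ ᘁg) = g ▷ W ≫ dualPairing W B f := by
  rw [dualPairing_apply, dualPairing_apply, MonoidalCategory.whiskerLeft_comp, Category.assoc,
    leftAdjointMate_comp_evaluation, whisker_exchange_assoc]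

variable (C) in
/-- The contravariant functor given by left duals. -/
def leftDualFunctor : Cᵒᵖ ⥤ C where
  obj X := ᘁX.unop
  map f := ᘁf.unop
  map_id _ := leftAdjointMate_id
  map_comp _ _ := comp_leftAdjointMate

/-- The instance is given explicitly so that the right dual of `ᘁY` is `Y` itself; a morphism X → Y
can then be recovered from its pairing X ⊗ ᘁY → 𝟙. -/
theorem tensorRightHomEquiv_comp_evaluation {X Y : C} (f : X ⟶ Y) :
    tensorRightHomEquiv X (ᘁY) Y (𝟙_ C) (f ▷ (ᘁY) ≫ evaluation (ᘁY) Y) = f ≫ (λ_ Y).inv :=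
  @tensorRightHomEquiv_whiskerRight_comp_evaluation C _ _ (ᘁY) X hasRightDualLeftDual f

/-- A morphism and its transpose correspond to the same pairing X ⊗ ᘁY → 𝟙, by two different
adjunctions. Full faithfulness of duality follows. -/
theorem dualPairing_leftAdjointMate {X Y : C} (f : X ⟶ Y) :
    dualPairing (ᘁY) X (ᘁf) = f ▷ (ᘁY) ≫ evaluation (ᘁY) Y := by
  rw [dualPairing_apply, leftAdjointMate_comp_evaluation]

theorem leftAdjointMate_injective {X Y : C} {f g : X ⟶ Y} (h : (ᘁf) = (ᘁg)) : f = g := by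
  rw [← cancel_mono (λ_ Y).inv, ← tensorRightHomEquiv_comp_evaluation,
    ← tensorRightHomEquiv_comp_evaluation, ← dualPairing_leftAdjointMate,
    ← dualPairing_leftAdjointMate, h]

theorem exists_leftAdjointMate_eq {X Y : C} (h : (ᘁY) ⟶ (ᘁX)) : ∃ f : X ⟶ Y, (ᘁf) = h := by
  refine ⟨tensorRightHomEquiv X (ᘁY) Y (𝟙_ C) (dualPairing (ᘁY) X h) ≫ (λ_ Y).hom, ?_⟩
  apply (dualPairing (ᘁY) X).injective
  apply (tensorRightHomEquiv X (ᘁY) Y (𝟙_ C)).injective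
  rw [dualPairing_leftAdjointMate, tensorRightHomEquiv_comp_evaluation, Category.assoc,
    Iso.hom_inv_id, Category.comp_id]

end

variable [RigidCategory C]

instance : (leftDualFunctor C).IsEquivalence where
  faithful := ⟨fun h => Quiver.Hom.unop_inj (leftAdjointMate_injective h)⟩
  full := ⟨fun h => by
    obtain ⟨f, hf⟩ := exists_leftAdjointMate_eq h
    exact ⟨f.op, hf⟩⟩
  -- Every object is a left dual of its right dual; here the existence of right duals enters.
  essSurj := ⟨fun A => ⟨Opposite.op (Aᘁ),
    ⟨leftDualIso (LeftRigidCategory.leftDual (Aᘁ)).exact HasRightDual.exact⟩⟩⟩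

end LeftDual

/-! ### Internal `Hom` to the dual module -/

section Dual

section

variable {C : Type u} [Category.{v} C] [MonoidalCategory C] [BraidedCategory C]
variable [LeftRigidCategory C] [MonoidalClosed C]

/-- Morphisms to the internal `Hom` from `Y` to the left dual of `X` are pairings with `Y ⊗ X`. -/
def homDualPairing (W Y X : C) : (W ⟶ (ihom Y).obj (ᘁX)) ≃ ((Y ⊗ X) ⊗ W ⟶ 𝟙_ C) :=
  (((ihom.adjunction Y).homEquiv W (ᘁX)).symm.trans (dualPairing (Y ⊗ W) X)).trans
    -- Uncurrying and then dualising gives a pairing on X ⊗ (Y ⊗ W); the braiding reorders it to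
    -- match Y ⊗_E X.
    (Iso.homFromEquiv ((whiskerRightIso (β_ Y X) W) ≪≫ α_ X Y W).symm)

theorem homDualPairing_apply {W Y X : C} (f : W ⟶ (ihom Y).obj (ᘁX)) :
    homDualPairing W Y X f = (β_ Y X).hom ▷ W ≫ (α_ X Y W).hom ≫
      dualPairing (Y ⊗ W) X (MonoidalClosed.uncurry f) :=
  Category.assoc _ _ _

theorem homDualPairing_comp {V W Y X : C} (h : V ⟶ W) (f : W ⟶ (ihom Y).obj (ᘁX)) :
    homDualPairing V Y X (h ≫ f) = (Y ⊗ X) ◁ h ≫ homDualPairing W Y X f := by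
  rw [homDualPairing_apply, homDualPairing_apply, MonoidalClosed.uncurry_natural_left,
    dualPairing_comp, whisker_exchange_assoc, tensor_whiskerLeft_symm_assoc,
    Iso.hom_inv_id_assoc]

theorem homDualPairing_comp_pre {W Y Y' X : C} (f : W ⟶ (ihom Y').obj (ᘁX)) (g : Y ⟶ Y') :
    homDualPairing W Y X (f ≫ (MonoidalClosed.pre g).app (ᘁX)) =
      (g ▷ X) ▷ W ≫ homDualPairing W Y' X f := by
  rw [homDualPairing_apply, homDualPairing_apply, MonoidalClosed.uncurry_pre_app,
    dualPairing_comp, ← comp_whiskerRight_assoc, BraidedCategory.braiding_naturality_left,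
    comp_whiskerRight_assoc, associator_naturality_middle_assoc]

theorem homDualPairing_comp_map {W Y X X' : C} (f : W ⟶ (ihom Y).obj (ᘁX')) (g : X ⟶ X') :
    homDualPairing W Y X (f ≫ (ihom Y).map (ᘁg)) =
      (Y ◁ g) ▷ W ≫ homDualPairing W Y X' f := by
  rw [homDualPairing_apply, homDualPairing_apply, MonoidalClosed.uncurry_natural_right,
    dualPairing_comp_mate, ← comp_whiskerRight_assoc, BraidedCategory.braiding_naturality_right,
    comp_whiskerRight_assoc, associator_naturality_left_assoc]

end

variable {k : Type*} [Field k] {E : Type w} [CommRing E] [Algebra k E] [Module.Finite k E]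
variable {C : Type u} [Category.{v} C] [Abelian C] [Linear k C]
variable [MonoidalCategory C] [MonoidalPreadditive C] [MonoidalLinear k C]

/-- Since − ⊗ W is right exact, (Y ⊗_E X) ⊗ W is still the quotient of (Y ⊗ X) ⊗ W by the two
actions of E. -/
theorem exists_tensorDesc_whiskerRight (hright : ∀ Z : C, exactFunctor C C (tensorRight Z))
    (Y X : EMod k E C) {W Z : C} (f : (Y.X ⊗ X.X) ⊗ W ⟶ Z)
    (hf : ∀ e, (Y.act e ▷ X.X) ▷ W ≫ f = (Y.X ◁ X.act e) ▷ W ≫ f) :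
    ∃ g : tensorObj Y X ⊗ W ⟶ Z, tensorπ Y X ▷ W ≫ g = f := by
  obtain ⟨_, _⟩ := (exactFunctor_iff _).1 (hright W)
  have hc := tensorπ_isCoinvariants Y X
  have hS : (ShortComplex.mk (barD₁ (actLeft Y X) (actRight Y X)) (tensorπ Y X)
      hc.barD₁_comp).Exact := by
    rw [ShortComplex.exact_iff_exact_up_to_refinements]
    exact hc.exact
  have hS' := hS.map (tensorRight W)
  have : Epi (tensorπ Y X ▷ W) := (tensorRight W).map_epi (tensorπ Y X)
  have : Epi ((ShortComplex.mk (barD₁ (actLeft Y X) (actRight Y X)) (tensorπ Y X)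
      hc.barD₁_comp).map (tensorRight W)).g := this
  have h0 : barD₁ (actLeft Y X) (actRight Y X) ▷ W ≫ f = 0 :=
    whiskerRight_copower_hom_ext (k := k) fun e => by
      have h1 : (actLeft Y X e - actRight Y X e) ▷ W ≫ f = 0 := by
        have := (tensorRight W).map_sub (f := actLeft Y X e) (g := actRight Y X e)
        change (actLeft Y X e - actRight Y X e) ▷ W = actLeft Y X e ▷ W - actRight Y X e ▷ W
          at this
        rw [this, Preadditive.sub_comp, sub_eq_zero]
        exact hf e
      rw [← comp_whiskerRight_assoc, ι_barD₁, h1, comp_zero]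
  exact ⟨hS'.desc f h0, hS'.g_desc f h0⟩

variable [BraidedCategory C] [LeftRigidCategory C] [MonoidalClosed C]

section

omit [Module.Finite k E]

/-- Morphisms to the internal `Hom` from `Y` to `X^∨` are pairings with `Y ⊗ X`. -/
def modPairing (W : C) (Y X : EMod k E C) :
    (W ⟶ (ihom Y.X).obj (dualMod X).X) ≃ ((Y.X ⊗ X.X) ⊗ W ⟶ 𝟙_ C) :=
  homDualPairing W Y.X X.X

theorem modPairing_comp {V W : C} {Y X : EMod k E C} (h : V ⟶ W)
    (f : W ⟶ (ihom Y.X).obj (dualMod X).X) :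
    modPairing V Y X (h ≫ f) = (Y.X ⊗ X.X) ◁ h ≫ modPairing W Y X f :=
  homDualPairing_comp h f

theorem modPairing_comp_pre {W : C} {Y Y' X : EMod k E C}
    (f : W ⟶ (ihom Y'.X).obj (dualMod X).X) (g : Y.X ⟶ Y'.X) :
    modPairing W Y X (f ≫ (MonoidalClosed.pre g).app (dualMod X).X) =
      (g ▷ X.X) ▷ W ≫ modPairing W Y' X f :=
  homDualPairing_comp_pre f g

/-- With `modPairing_comp_actTarget`, this turns equalising the two actions on Hom(Y, X^∨) into
coequalising the two actions on Y ⊗ X. -/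
theorem modPairing_comp_actSource {W : C} {Y X : EMod k E C}
    (f : W ⟶ (ihom Y.X).obj (dualMod X).X) (e : E) :
    modPairing W Y X (f ≫ ihomActSource Y (dualMod X) e) =
      (Y.act e ▷ X.X) ▷ W ≫ modPairing W Y X f :=
  homDualPairing_comp_pre f (Y.act e)

theorem modPairing_comp_actTarget {W : C} {Y X : EMod k E C}
    (f : W ⟶ (ihom Y.X).obj (dualMod X).X) (e : E) :
    modPairing W Y X (f ≫ ihomActTarget Y (dualMod X) e) =
      (Y.X ◁ X.act e) ▷ W ≫ modPairing W Y X f :=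
  homDualPairing_comp_map f (X.act e)

end

/-- Maps from W to Hom_E(Y, X^∨) and maps from W to (Y ⊗_E X)^∨ both amount to pairings on (Y ⊗ X) ⊗
W balanced over E. The comparison map comes from the universal such pairing, with W = Hom_E(Y, X^∨).
-/
theorem exists_homToDual (hright : ∀ Z : C, exactFunctor C C (tensorRight Z))
    (Y X : EMod k E C) : ∃ t : homObj Y (dualMod X) ⟶ ᘁ(tensorObj Y X),
      tensorπ Y X ▷ _ ≫ dualPairing _ _ t = modPairing _ Y X (homι Y (dualMod X)) := by
  obtain ⟨g, hg⟩ := exists_tensorDesc_whiskerRight hright Y X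
    (modPairing _ Y X (homι Y (dualMod X))) fun e => by
      rw [← modPairing_comp_actSource, ← modPairing_comp_actTarget, hom_condition]
  exact ⟨(dualPairing _ _).symm g, by rw [Equiv.apply_symm_apply, hg]⟩

/-- The canonical morphism from `Hom_E(Y, X^∨)` to the dual of `Y ⊗_E X`. -/
def homToDual (hright : ∀ Z : C, exactFunctor C C (tensorRight Z)) (Y X : EMod k E C) :
    homObj Y (dualMod X) ⟶ ᘁ(tensorObj Y X) :=
  (exists_homToDual hright Y X).choose

theorem homToDual_spec (hright : ∀ Z : C, exactFunctor C C (tensorRight Z)) (Y X : EMod k E C) :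
    tensorπ Y X ▷ _ ≫ dualPairing _ _ (homToDual hright Y X) =
      modPairing _ Y X (homι Y (dualMod X)) :=
  (exists_homToDual hright Y X).choose_spec

/-- The canonical morphism from the dual of `Y ⊗_E X` to `Hom_E(Y, X^∨)`. -/
def dualToHom (Y X : EMod k E C) : (ᘁ(tensorObj Y X)) ⟶ homObj Y (dualMod X) :=
  homLift Y (dualMod X) ((modPairing _ Y X).symm
    (tensorπ Y X ▷ _ ≫ dualPairing _ (tensorObj Y X) (𝟙 _))) fun e => by
      apply (modPairing _ Y X).injective
      rw [modPairing_comp_actSource, modPairing_comp_actTarget, Equiv.apply_symm_apply,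
        ← comp_whiskerRight_assoc, ← comp_whiskerRight_assoc, tensor_condition]

theorem modPairing_dualToHom (Y X : EMod k E C) :
    modPairing _ Y X (dualToHom Y X ≫ homι Y (dualMod X)) =
      tensorπ Y X ▷ _ ≫ dualPairing _ (tensorObj Y X) (𝟙 _) := by
  rw [dualToHom, homLift_ι, Equiv.apply_symm_apply]

/-- `Hom_E(Y, X^∨)` is the dual of `Y ⊗_E X`. -/
def homIsoDual (hright : ∀ Z : C, exactFunctor C C (tensorRight Z)) (Y X : EMod k E C) :
    homObj Y (dualMod X) ≅ ᘁ(tensorObj Y X) where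
  hom := homToDual hright Y X
  inv := dualToHom Y X
  hom_inv_id := homObj_hom_ext Y (dualMod X) ((modPairing _ Y X).injective (by
    rw [Category.assoc, modPairing_comp, modPairing_dualToHom, whisker_exchange_assoc,
      ← dualPairing_comp, Category.comp_id, homToDual_spec, Category.id_comp]))
  inv_hom_id := (dualPairing _ _).injective (by
    obtain ⟨_, _⟩ := (exactFunctor_iff _).1 (hright (ᘁ(tensorObj Y X)))
    have : Epi (tensorπ Y X ▷ (ᘁ(tensorObj Y X))) :=
      (tensorRight (ᘁ(tensorObj Y X))).map_epi (tensorπ Y X)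
    rw [← cancel_epi (tensorπ Y X ▷ (ᘁ(tensorObj Y X))), dualPairing_comp,
      ← whisker_exchange_assoc, homToDual_spec, ← modPairing_dualToHom, modPairing_comp])

theorem homToDual_naturality (hright : ∀ Z : C, exactFunctor C C (tensorRight Z))
    {Y Y' : EMod k E C} (f : Y ⟶ Y') (X : EMod k E C) :
    homPre f (dualMod X) ≫ homToDual hright Y X =
      homToDual hright Y' X ≫ ᘁ(tensorMap f X) := by
  apply (dualPairing _ _).injective
  obtain ⟨_, _⟩ := (exactFunctor_iff _).1 (hright (homObj Y' (dualMod X)))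
  have : Epi (tensorπ Y X ▷ homObj Y' (dualMod X)) :=
    (tensorRight (homObj Y' (dualMod X))).map_epi (tensorπ Y X)
  rw [← cancel_epi (tensorπ Y X ▷ homObj Y' (dualMod X)), dualPairing_comp_mate,
    dualPairing_comp, ← whisker_exchange_assoc, homToDual_spec, ← comp_whiskerRight_assoc,
    tensorπ_map, comp_whiskerRight_assoc, homToDual_spec, ← modPairing_comp, homPre_ι,
    modPairing_comp_pre]

/-- `Hom_E(-, X^∨)` is the dual of `- ⊗_E X`. -/
def homFunctorIso (hright : ∀ Z : C, exactFunctor C C (tensorRight Z)) (X : EMod k E C) :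
    homFunctor (dualMod X) ⋙ EMod.forget k E C ≅
      (tensorFunctor X ⋙ EMod.forget k E C).op ⋙ leftDualFunctor C :=
  NatIso.ofComponents (fun Y => homIsoDual hright Y.unop X)
    fun f => homToDual_naturality hright f.unop X

end Dual

/-! ### Exactness under opposites and equivalences. -/

theorem exactFunctor_op_iff {C D : Type*} [Category* C] [Category* D] (F : C ⥤ D) :
    exactFunctor Cᵒᵖ Dᵒᵖ F.op ↔ exactFunctor C D F := by
  rw [exactFunctor_iff, exactFunctor_iff]
  constructor
  · rintro ⟨_, _⟩
    exact ⟨preservesFiniteLimits_of_op F, preservesFiniteColimits_of_op F⟩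
  · rintro ⟨_, _⟩
    exact ⟨preservesFiniteLimits_op F, preservesFiniteColimits_op F⟩

theorem exactFunctor_comp_equivalence_iff {A B D : Type*} [Category* A] [Category* B]
    [Category* D] (F : A ⥤ B) (G : B ⥤ D) [G.IsEquivalence] :
    exactFunctor A D (F ⋙ G) ↔ exactFunctor A B F := by
  constructor
  · intro h
    refine ((exactFunctor _ _).prop_iff_of_iso ((Functor.rightUnitor F).symm ≪≫
      Functor.isoWhiskerLeft F G.asEquivalence.unitIso)).2 ?_
    obtain ⟨_, _⟩ := (exactFunctor_iff _).1 h
    exact ⟨comp_preservesFiniteLimits (F ⋙ G) G.inv,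
      comp_preservesFiniteColimits (F ⋙ G) G.inv⟩
  · rintro h
    obtain ⟨_, _⟩ := (exactFunctor_iff _).1 h
    exact ⟨comp_preservesFiniteLimits _ _, comp_preservesFiniteColimits _ _⟩

end LinCat

end

theorem mainTheorem10 {k : Type*} [Field k] {E : Type w} [CommRing E] [Algebra k E]
    [QuasiSeparable k E]
    {C : Type u} [Category.{v} C] [Abelian C] [Linear k C]
    [MonoidalCategory C] [SymmetricCategory C] [MonoidalPreadditive C] [MonoidalLinear k C]
    (hleft : ∀ Z : C, exactFunctor C C (tensorLeft Z))
    (hright : ∀ Z : C, exactFunctor C C (tensorRight Z))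
    (X : LinCat.EMod k E C) :
    (LinCat.IsFlat X →
      exactFunctor (LinCat.EMod k E C) (LinCat.EMod k E C) (LinCat.tensorFunctor X)) ∧
    (∀ [RigidCategory C],
      letI : MonoidalClosed C := monoidalClosedOfLeftRigidCategory C
      [LinCat.IsFlat X,
        exactFunctor (LinCat.EMod k E C) (LinCat.EMod k E C) (LinCat.tensorFunctor X),
        exactFunctor (LinCat.EMod k E C)ᵒᵖ (LinCat.EMod k E C)
          (LinCat.homFunctor (LinCat.dualMod X))].TFAE) := by
  have : Algebra.IsSeparable k (E ⧸ nilradical E) := QuasiSeparable.separable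
  refine ⟨LinCat.tensorFunctor_exact hleft hright, ?_⟩
  intro _
  let _ : MonoidalClosed C := monoidalClosedOfLeftRigidCategory C
  tfae_have 1 → 2 := LinCat.tensorFunctor_exact hleft hright
  tfae_have 2 → 1 := LinCat.isFlat_of_tensorFunctor_exact X
  -- Exactness is compared after forgetting to `C`, so the identification of Hom_E(Y, X^∨) with the
  -- dual of Y ⊗_E X need only be natural in Y, not E-linear.
  tfae_have 3 ↔ 2 := by
    rw [LinCat.EMod.exactFunctor_iff_comp_forget,
      (exactFunctor _ _).prop_iff_of_iso (LinCat.homFunctorIso hright X),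
      LinCat.exactFunctor_comp_equivalence_iff, LinCat.exactFunctor_op_iff,
      ← LinCat.EMod.exactFunctor_iff_comp_forget]
  tfae_finish
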